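/- Let $(\xi_1,\xi_2)$ be a random vector in $\mathbb{C}^2$ such that $\xi_1$ and $\xi_2$ have unit variance, i.e. $\mathbb{E}|\xi_i|^2<\infty$ and $\mathbb{E}|\xi_i-\mathbb{E}\xi_i|^2=1$ for $i=1,2$ (their means need not be zero). Assume that there exist $\varepsilon_0,\delta_0>0$ such that, almost surely, $$\sup_{w\in\mathbb{C}}\mathbb{P}(|\xi_1-w|\le\delta_0\mid\xi_2)\le 1-\varepsilon_0\quad\text{and}\quad \sup_{w\in\mathbb{C}}\mathbb{P}(|\xi_2-w|\le\delta_0\mid\xi_1)\le 1-\varepsilon_0,$$ where the conditional probabilities are regular conditional probabilities. Fix $z\in\mathbb{C}$ with $z\ne0$. Then there is a constant $c>0$, depending only on $z$ and the distribution of $(\xi_1,\xi_2)$, such that the following holds. For each $n$ let $X=X^{(n)}$ be an $n\times n$ complex random matrix such that $\{X_{ii}:1\le i\le n\}\cup\{(X_{ij},X_{ji}):1\le i<j\le n\}$ is a collection of independent random elements and each pair $(X_{ij},X_{ji})$, $i<j$, has the same distribution as $(\xi_1,\xi_2)$ (nothing else is assumed about the diagonal entries, and matrices of different sizes may be defined on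 different probability spaces). Let $L=X-D$, where $D$ is the diagonal matrix with $D_{ii}=\sum_{k=1}^nX_{ik}$, let $I_n$ be the $n\times n$ identity matrix, and let $s_n(A)$ denote the least singular value of an $n\times n$ matrix $A$. Then $$\lim_{n\to\infty}\mathbb{P}\bigl(s_n(L-z\sqrt n\,I_n)\le n^{-c}\bigr)=0.$$ -/

import Mathlib

open MeasureTheory ProbabilityTheory Filter Topology

/-- A complex random variable has unit variance: it has a finite second moment and
`𝔼 |ξ - 𝔼 ξ|² = 1`. No value is prescribed for its mean. -/
def HasUnitVariance {Ω : Type*} [MeasurableSpace Ω] (P : Measure Ω) (ξ : Ω → ℂ) : Prop :=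
  MemLp ξ 2 P ∧ ∫ ω, ‖ξ ω - ∫ ω', ξ ω' ∂P‖ ^ 2 ∂P = 1

/-- There are `ε₀, δ₀ > 0` such that, almost surely,
`sup_z P(|ξ₁ - z| ≤ δ₀ | ξ₂) ≤ 1 - ε₀` and `sup_z P(|ξ₂ - z| ≤ δ₀ | ξ₁) ≤ 1 - ε₀`, where the
conditional probabilities are regular conditional probabilities. -/
def IsConditionallySpread {Ω : Type*} [MeasurableSpace Ω] (P : Measure Ω) [IsFiniteMeasure P]
    (ξ₁ ξ₂ : Ω → ℂ) : Prop :=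
  ∃ ε₀ δ₀ : ℝ, 0 < ε₀ ∧ 0 < δ₀ ∧ ∀ᵐ ω ∂P,
    (⨆ z : ℂ, condDistrib ξ₁ ξ₂ P (ξ₂ ω) (Metric.closedBall z δ₀)) ≤ ENNReal.ofReal (1 - ε₀) ∧
    (⨆ z : ℂ, condDistrib ξ₂ ξ₁ P (ξ₁ ω) (Metric.closedBall z δ₀)) ≤ ENNReal.ofReal (1 - ε₀)

/-- `X` is an `n × n` random matrix on the probability space `(Ω, P)` such that the diagonal
entries `X i i` and the pairs `(X i j, X j i)`, `i < j`, form an independent collection, and every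
pair `(X i j, X j i)`, `i < j`, is distributed as the atom vector `(ξ₁, ξ₂)` given on `(Ω₀, P₀)`.
The laws of the diagonal entries are arbitrary, and may differ from each other. -/
structure IsEllipticMatrix {Ω₀ : Type*} [MeasurableSpace Ω₀] (P₀ : Measure Ω₀) (ξ₁ ξ₂ : Ω₀ → ℂ)
    {Ω : Type*} [MeasurableSpace Ω] (P : Measure Ω) {n : ℕ}
    (X : Ω → Matrix (Fin n) (Fin n) ℂ) : Prop where
  measurable_entry : ∀ i j, Measurable fun ω => X ω i j
  /-- The collection is indexed by the pairs `i ≤ j`; for `i = j` the member `(X i i, X i i)`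
  generates the same σ-algebra as `X i i`. -/
  indep : iIndepFun (fun (p : {p : Fin n × Fin n // p.1 ≤ p.2}) (ω : Ω) =>
    (X ω p.1.1 p.1.2, X ω p.1.2 p.1.1)) P
  identDistrib : ∀ i j, i < j →
    IdentDistrib (fun ω => (X ω i j, X ω j i)) (fun ω => (ξ₁ ω, ξ₂ ω)) P P₀

/-- The Laplacian matrix `L = X - D`, where `D` is the diagonal matrix of the row sums of `X`. -/
def laplacianMatrix {n : ℕ} (X : Matrix (Fin n) (Fin n) ℂ) : Matrix (Fin n) (Fin n) ℂ :=
  X - Matrix.diagonal fun i => ∑ k, X i k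

/-- The least singular value `s_n(A)` of an `n × n` complex matrix `A` with `n ≥ 1`. Mathlib lists
the singular values in decreasing order starting from the index `0`, so this is the one with
index `n - 1`. -/
noncomputable def leastSingularValue {n : ℕ} (A : Matrix (Fin n) (Fin n) ℂ) : ℝ :=
  (Matrix.toEuclideanLin A).singularValues (n - 1)

/-!
The matrix `M = L - z √n` acts by `(M u)ⱼ = ∑ₖ Xⱼₖ (uₖ - uⱼ) - z √n uⱼ`. The key observation is that,
conditionally on all entries outside row `i`, the entries `Xᵢₖ`, `k ≠ i`, are still independent, and
by the spread hypothesis each conditional law is nondegenerate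
(`IsEllipticMatrix.measure_le_of_forall_update`). Hence the correlation between `Xᵢₖ` and `Xₖᵢ` does
no harm, no quadratic forms appear, and linear anticoncentration in one row suffices.

If the least singular value is at most `τ`, there is a unit vector `y` with `yᵀ M` of size at most
`τ`. For a unit vector `u` orthogonal to all rows except row `i` this gives `|yᵢ| |(M u)ᵢ| ≤ n τ`.
Two facts are needed. First, with high probability `y` is not negligible off any `m ≈ n ^ (3/4)`
coordinates, and no such `u` is nearly constant off `m` coordinates. Both follow from a union bound
over a net of vectors supported on `m` coordinates: the net has mesh a power of `1 / n` and
`n ^ O(m)` points, while a fixed sparse vector is an approximate null vector only with probability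
exponentially small in `n`, even though the entries of `M` are bounded only by a power of `n`. The
transposed case has to exclude constant vectors, and this is where `z ≠ 0` enters: constants are
eigenvectors of `M` with eigenvalue `-z √n`.

Second, `(M u)ᵢ = ∑ₖ Xᵢₖ (uₖ - uᵢ) - z √n uᵢ` then has more than `m` coefficients `uₖ - uᵢ` that are
not negligible, so by a Littlewood–Offord inequality (symmetrization and Sperner's theorem,
`measureReal_sum_near_le`) it is tiny with probability `O(m ^ (-1/2))`. At least `m` of the `n` rows
would have to be tiny in this sense, so by Markov's inequality the exceptional probability is
`O((n / m) m ^ (-1/2)) = O(n ^ (-1/8))`. The exponent `c = 22` works for all laws and all `z`.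
-/

/-! ### Counting subset sums: the Littlewood–Offord inequality -/

lemma sq_centralBinom_mul_le (s : ℕ) : s.centralBinom ^ 2 * (2 * s + 1) ≤ 16 ^ s := by
  induction s with
  | zero => simp
  | succ s ih =>
    have h := Nat.succ_mul_centralBinom_succ s
    have h1 : ((s + 1) * (s + 1).centralBinom) ^ 2 * (2 * (s + 1) + 1)
        ≤ (s + 1) ^ 2 * 16 ^ (s + 1) := by
      rw [h]
      calc (2 * (2 * s + 1) * s.centralBinom) ^ 2 * (2 * (s + 1) + 1)
          = (s.centralBinom ^ 2 * (2 * s + 1)) * (4 * ((2 * s + 1) * (2 * s + 3))) := by ring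
        _ ≤ 16 ^ s * (4 * ((2 * s + 1) * (2 * s + 3))) := Nat.mul_le_mul_right _ ih
        _ ≤ 16 ^ s * (16 * (s + 1) ^ 2) := Nat.mul_le_mul_left _ (by nlinarith)
        _ = (s + 1) ^ 2 * 16 ^ (s + 1) := by ring
    have h2 : 0 < (s + 1) ^ 2 := by positivity
    refine Nat.le_of_mul_le_mul_left (c := (s + 1) ^ 2) ?_ h2
    linarith [h1, mul_pow (s + 1) (s + 1).centralBinom 2,
      show ((s + 1) * (s + 1).centralBinom) ^ 2 * (2 * (s + 1) + 1)
        = (s + 1) ^ 2 * ((s + 1).centralBinom ^ 2 * (2 * (s + 1) + 1)) by ring]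

lemma sq_choose_half_mul_le (q : ℕ) : q.choose (q / 2) ^ 2 * (q + 1) ≤ 4 ^ q := by
  obtain ⟨s, rfl | rfl⟩ := Nat.even_or_odd' q
  · have := sq_centralBinom_mul_le s
    rw [Nat.centralBinom] at this
    rw [Nat.mul_div_cancel_left s two_pos, pow_mul]
    exact this
  · have h := sq_centralBinom_mul_le (s + 1)
    have h2 : (s + 1).centralBinom = 2 * (2 * s + 1).choose s := by
      rw [Nat.centralBinom, show 2 * (s + 1) = 2 * s + 1 + 1 by ring, Nat.choose_succ_succ,
        Nat.choose_symm_half]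
      ring
    rw [h2] at h
    have h3 : (2 * s + 1) / 2 = s := by omega
    have h4 : (4 : ℕ) ^ (2 * s + 1) = 4 * 16 ^ s := by
      rw [pow_succ, pow_mul]; norm_num [mul_comm]
    rw [h3, h4]
    rw [pow_succ 16 s] at h
    nlinarith [sq_nonneg ((2 * s + 1).choose s)]

lemma choose_half_le (q : ℕ) : (q.choose (q / 2) : ℝ) ≤ 2 ^ q / √(q + 1) := by
  rw [le_div_iff₀ (by positivity)]
  refine le_of_sq_le_sq ?_ (by positivity)
  rw [mul_pow, Real.sq_sqrt (by positivity), ← pow_mul, mul_comm q 2, pow_mul]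
  norm_num
  exact_mod_cast sq_choose_half_mul_le q

/-- If the subset sums of `e` were within `r` of `w` for two nested sets agreeing off `T`, their
difference would be a sum of terms larger than `2 r`; so on each fibre of `A ↦ A \ T` the sets form
an antichain, to which Sperner's theorem applies. -/
lemma card_subsetSum_near_le {ι : Type*} [Fintype ι] [DecidableEq ι] (e : ι → ℝ) (T : Finset ι)
    {r : ℝ} (w : ℝ) (hr : 0 ≤ r) (he : ∀ k ∈ T, 2 * r < e k) :
    (Finset.univ.filter fun A : Finset ι => |∑ k ∈ A, e k - w| ≤ r).card
      ≤ 2 ^ (Fintype.card ι - T.card) * T.card.choose (T.card / 2) := by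
  set F := Finset.univ.filter fun A : Finset ι => |∑ k ∈ A, e k - w| ≤ r with hF
  have hmaps : Set.MapsTo (fun A : Finset ι => A \ T) F (Finset.univ \ T).powerset := by
    intro A _
    simp only [Finset.coe_powerset, Set.mem_preimage, Set.mem_powerset_iff, Finset.coe_subset]
    exact Finset.sdiff_subset_sdiff (Finset.subset_univ _) le_rfl
  rw [Finset.card_eq_sum_card_fiberwise hmaps]
  have hfib : ∀ B ∈ (Finset.univ \ T).powerset,
      (F.filter fun A => A \ T = B).card ≤ T.card.choose (T.card / 2) := by
    intro B _
    let φ : Finset ι → Finset T := fun A => A.subtype (· ∈ T)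
    have hinj : Set.InjOn φ (F.filter fun A => A \ T = B) := by
      intro A hA A' hA' hAA
      simp only [Finset.coe_filter, Set.mem_ofPred_eq] at hA hA'
      ext k
      by_cases hk : k ∈ T
      · have := congrArg (fun s : Finset T => (⟨k, hk⟩ : T) ∈ s) hAA
        simpa [φ] using this
      · have h1 : k ∈ A \ T ↔ k ∈ A' \ T := by rw [hA.2, hA'.2]
        simpa [hk] using h1
    rw [← Finset.card_image_of_injOn hinj]
    have hanti : IsAntichain (· ⊆ ·)
        (((F.filter fun A => A \ T = B).image φ : Finset (Finset T)) : Set (Finset T)) := by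
      intro s hs s' hs' hne hss
      simp only [Finset.coe_image, Set.mem_image, Finset.mem_coe] at hs hs'
      obtain ⟨A, hA, rfl⟩ := hs
      obtain ⟨A', hA', rfl⟩ := hs'
      rw [Finset.mem_filter, hF, Finset.mem_filter] at hA hA'
      have hsub : A ⊆ A' := by
        intro k hk
        by_cases hkT : k ∈ T
        · have : (⟨k, hkT⟩ : T) ∈ φ A := by simpa [φ] using hk
          simpa [φ] using hss this
        · have : k ∈ A \ T := by simp [hk, hkT]
          rw [hA.2, ← hA'.2] at this
          exact (Finset.mem_sdiff.1 this).1
      have hdT : A' \ A ⊆ T := by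
        intro k hk
        rw [Finset.mem_sdiff] at hk
        by_contra hkT
        have : k ∈ A' \ T := by simp [hk.1, hkT]
        rw [hA'.2, ← hA.2] at this
        exact hk.2 (Finset.mem_sdiff.1 this).1
      have hnonempty : (A' \ A).Nonempty := by
        rw [Finset.sdiff_nonempty]
        intro h
        exact hne (by rw [Finset.Subset.antisymm hsub h])
      obtain ⟨k, hk⟩ := hnonempty
      have hsum : ∑ k ∈ A' \ A, e k + ∑ k ∈ A, e k = ∑ k ∈ A', e k :=
        Finset.sum_sdiff hsub
      have hge : e k ≤ ∑ k ∈ A' \ A, e k :=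
        Finset.single_le_sum (fun j hj => by linarith [he j (hdT hj)]) hk
      have := he k (hdT hk)
      have h1 := abs_le.1 hA.1.2
      have h2 := abs_le.1 hA'.1.2
      linarith [h1.1, h2.2]
    have := hanti.sperner
    simpa using this
  refine (Finset.sum_le_card_nsmul _ _ _ hfib).trans ?_
  rw [Finset.card_powerset, Finset.card_sdiff_of_subset (Finset.subset_univ T), Finset.card_univ,
    smul_eq_mul]

/-- Since `‖x‖ ≤ |re x| + |im x|`, each long step is half as long in one of the directions `±1`,
`±i`, so some direction serves a quarter of the steps. -/
lemma exists_quarter_subset_re_im {ι : Type*} [DecidableEq ι] (d : ι → ℂ) (T : Finset ι) {r : ℝ}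
    (hd : ∀ k ∈ T, 4 * r < ‖d k‖) :
    ∃ ℓ : ℂ →ₗ[ℝ] ℝ, (∀ x, |ℓ x| ≤ ‖x‖) ∧
      T.card ≤ 4 * (T.filter fun k => 2 * r < ℓ (d k)).card := by
  by_contra! h
  have h1 := h Complex.reLm (fun x => Complex.abs_re_le_norm x)
  have h2 := h (-Complex.reLm) (fun x => by simpa using Complex.abs_re_le_norm x)
  have h3 := h Complex.imLm (fun x => Complex.abs_im_le_norm x)
  have h4 := h (-Complex.imLm) (fun x => by simpa using Complex.abs_im_le_norm x)
  have hcov : T ⊆ ((T.filter fun k => 2 * r < Complex.reLm (d k)) ∪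
      (T.filter fun k => 2 * r < (-Complex.reLm) (d k))) ∪
      ((T.filter fun k => 2 * r < Complex.imLm (d k)) ∪
      (T.filter fun k => 2 * r < (-Complex.imLm) (d k))) := by
    intro k hk
    have hk1 := hd k hk
    have hk2 := Complex.norm_le_abs_re_add_abs_im (d k)
    by_contra hcon
    simp only [Finset.mem_union, Finset.mem_filter, hk, true_and, not_or, not_lt] at hcon
    simp only [Complex.reLm_coe, Complex.imLm_coe, LinearMap.neg_apply] at hcon
    have h5 : |(d k).re| ≤ 2 * r := abs_le.2 ⟨by linarith [hcon.1.2], hcon.1.1⟩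
    have h6 : |(d k).im| ≤ 2 * r := abs_le.2 ⟨by linarith [hcon.2.2], hcon.2.1⟩
    linarith
  have hc := Finset.card_le_card hcov
  have hu1 := Finset.card_union_le ((T.filter fun k => 2 * r < Complex.reLm (d k)) ∪
      (T.filter fun k => 2 * r < (-Complex.reLm) (d k)))
      ((T.filter fun k => 2 * r < Complex.imLm (d k)) ∪
      (T.filter fun k => 2 * r < (-Complex.imLm) (d k)))
  have hu2 := Finset.card_union_le (T.filter fun k => 2 * r < Complex.reLm (d k))
      (T.filter fun k => 2 * r < (-Complex.reLm) (d k))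
  have hu3 := Finset.card_union_le (T.filter fun k => 2 * r < Complex.imLm (d k))
      (T.filter fun k => 2 * r < (-Complex.imLm) (d k))
  omega

/-- Complex Littlewood–Offord inequality: at least a quarter of the steps are long in one of the
four directions `±1`, `±i`, and projecting to that direction reduces to real steps of one sign. -/
lemma card_complexSubsetSum_near_le {ι : Type*} [Fintype ι] [DecidableEq ι] (d : ι → ℂ)
    (T : Finset ι) {r : ℝ} (w : ℂ) (hr : 0 ≤ r) (hd : ∀ k ∈ T, 4 * r < ‖d k‖) :
    ((Finset.univ.filter fun A : Finset ι => ‖∑ k ∈ A, d k - w‖ ≤ r).card : ℝ)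
      ≤ 2 ^ Fintype.card ι * (2 / √(T.card + 1)) := by
  obtain ⟨ℓ, hℓ, hcard⟩ := exists_quarter_subset_re_im d T hd
  set T' := T.filter fun k => 2 * r < ℓ (d k)
  have hsub : (Finset.univ.filter fun A : Finset ι => ‖∑ k ∈ A, d k - w‖ ≤ r) ⊆
      Finset.univ.filter fun A : Finset ι => |∑ k ∈ A, ℓ (d k) - ℓ w| ≤ r := by
    intro A hA
    simp only [Finset.mem_filter, Finset.mem_univ, true_and] at hA ⊢
    rw [← map_sum, ← map_sub]
    exact (hℓ _).trans hA
  have h1 := (Finset.card_le_card hsub).trans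
    (card_subsetSum_near_le (fun k => ℓ (d k)) T' (ℓ w) hr
      (fun k hk => (Finset.mem_filter.1 hk).2))
  have hT' : T'.card ≤ Fintype.card ι := Finset.card_le_univ _
  have h2 : (2 : ℝ) ^ (Fintype.card ι - T'.card) * (T'.card.choose (T'.card / 2) : ℝ)
      ≤ 2 ^ Fintype.card ι * (1 / √(T'.card + 1)) := by
    calc (2 : ℝ) ^ (Fintype.card ι - T'.card) * (T'.card.choose (T'.card / 2) : ℝ)
        ≤ 2 ^ (Fintype.card ι - T'.card) * (2 ^ T'.card / √(T'.card + 1)) := by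
          gcongr; exact choose_half_le _
      _ = 2 ^ Fintype.card ι * (1 / √(T'.card + 1)) := by
          rw [← pow_sub_mul_pow (2 : ℝ) hT']; ring
  have h3 : (1 : ℝ) / √(T'.card + 1) ≤ 2 / √(T.card + 1) := by
    rw [div_le_div_iff₀ (by positivity) (by positivity), one_mul]
    have : (2 : ℝ) = √4 := by
      rw [show (4 : ℝ) = 2 ^ 2 by norm_num]; simp
    rw [this, ← Real.sqrt_mul (by norm_num)]
    apply Real.sqrt_le_sqrt
    have : (T.card : ℝ) ≤ 4 * T'.card := by exact_mod_cast hcard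
    linarith
  refine (Nat.cast_le.2 h1).trans ?_
  push_cast
  exact h2.trans (by gcongr)

/-! ### Anticoncentration of sums of independent spread variables -/

/-- The law `μ` gives mass at most `1 - ε` to every closed disc of radius `δ`. -/
def IsSpreadLaw (ε δ : ℝ) (μ : Measure ℂ) : Prop :=
  ∀ w, μ.real (Metric.closedBall w δ) ≤ 1 - ε

/-- One factor of the exponential moment `𝔼 2⁻ᴺ`, where `N` counts the coordinates at which two
independent copies are more than `δ` apart. -/
lemma IsSpreadLaw.integral_half_of_far_le {ε δ : ℝ} {μ : Measure ℂ} [IsProbabilityMeasure μ]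
    (h : IsSpreadLaw ε δ μ) :
    ∫ ω : ℂ × ℂ, (if δ < ‖ω.1 - ω.2‖ then (1 / 2 : ℝ) else 1) ∂(μ.prod μ) ≤ 1 - ε / 2 := by
  have hms : MeasurableSet {ω : ℂ × ℂ | ‖ω.1 - ω.2‖ ≤ δ} :=
    measurableSet_le (by fun_prop) (by fun_prop)
  have hfun : (fun ω : ℂ × ℂ => if δ < ‖ω.1 - ω.2‖ then (1 / 2 : ℝ) else 1)
      = fun ω => 1 / 2 + {ω : ℂ × ℂ | ‖ω.1 - ω.2‖ ≤ δ}.indicator (fun _ => (1 / 2 : ℝ)) ω := by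
    ext ω
    by_cases hω : ‖ω.1 - ω.2‖ ≤ δ
    · simp [hω, not_lt.2 hω]; norm_num
    · simp [hω, not_le.1 hω]
  rw [hfun, integral_add (integrable_const _) ((integrable_const _).indicator hms),
    integral_indicator_const _ hms]
  have hle : (μ.prod μ).real {ω : ℂ × ℂ | ‖ω.1 - ω.2‖ ≤ δ} ≤ 1 - ε := by
    have h1 : (0 : ℝ) ≤ 1 - ε := measureReal_nonneg.trans (h 0)
    refine ENNReal.toReal_le_of_le_ofReal h1 ?_
    rw [Measure.prod_apply hms]
    calc ∫⁻ x, μ (Prod.mk x ⁻¹' {ω : ℂ × ℂ | ‖ω.1 - ω.2‖ ≤ δ}) ∂μ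
        ≤ ∫⁻ _, ENNReal.ofReal (1 - ε) ∂μ := by
          refine lintegral_mono fun x => ?_
          have : Prod.mk x ⁻¹' {ω : ℂ × ℂ | ‖ω.1 - ω.2‖ ≤ δ} = Metric.closedBall x δ := by
            ext y; simp [dist_eq_norm, norm_sub_rev]
          rw [this, ← ofReal_measureReal]
          exact ENNReal.ofReal_le_ofReal (h x)
      _ = ENNReal.ofReal (1 - ε) := by simp
  simp only [integral_const, probReal_univ, smul_eq_mul]
  linarith

/-- Choosing each coordinate from one of two independent copies does not change a product law. -/
lemma map_pi_prod_choose {ι : Type*} [Fintype ι] [DecidableEq ι] (μ : ι → Measure ℂ)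
    [∀ k, IsProbabilityMeasure (μ k)] (A : Finset ι) :
    (Measure.pi fun k => (μ k).prod (μ k)).map
      (fun ω k => if k ∈ A then (ω k).1 else (ω k).2) = Measure.pi μ := by
  have key : ∀ k, ((μ k).prod (μ k)).map (fun p : ℂ × ℂ => if k ∈ A then p.1 else p.2) = μ k := by
    intro k
    by_cases hk : k ∈ A
    · simp only [hk, if_true]
      simp [Measure.map_fst_prod]
    · simp only [hk, if_false]
      simp [Measure.map_snd_prod]
  have hmeas : ∀ k, Measurable (fun p : ℂ × ℂ => if k ∈ A then p.1 else p.2) := by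
    intro k
    by_cases hk : k ∈ A <;> simp only [hk, if_true, if_false] <;> fun_prop
  have hp : ∀ k, IsProbabilityMeasure
      (((μ k).prod (μ k)).map (fun p : ℂ × ℂ => if k ∈ A then p.1 else p.2)) := by
    intro k; rw [key k]; infer_instance
  rw [Measure.pi_map_pi (fun k => (hmeas k).aemeasurable)]
  congr 1
  ext1 k
  exact key k

/-- Anticoncentration: resample every coordinate from two independent copies with fair bits. Given
the copies, the bits give a Littlewood–Offord problem with one step for each coordinate at which the
copies are `δ`-apart. Fewer than `q` such coordinates in `T` is unlikely by an exponential moment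
bound, which accounts for the second summand. -/
theorem measureReal_sum_near_le {ι : Type*} [Fintype ι] [DecidableEq ι] (μ : ι → Measure ℂ)
    [∀ k, IsProbabilityMeasure (μ k)] {ε δ r : ℝ} (hr : 0 ≤ r) (T : Finset ι)
    (hμ : ∀ k ∈ T, IsSpreadLaw ε δ (μ k)) (a : ι → ℂ) (ha0 : ∀ k ∈ T, a k ≠ 0)
    (ha : ∀ k ∈ T, 4 * r ≤ ‖a k‖ * δ) (w : ℂ) (q : ℕ) :
    (Measure.pi μ).real {x | ‖∑ k, a k * x k - w‖ ≤ r}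
      ≤ 2 / √(q + 1) + 2 * 2 ^ q * (1 - ε / 2) ^ T.card := by
  set Q := Measure.pi fun k => (μ k).prod (μ k) with hQ
  set S : Set (ι → ℂ) := {x | ‖∑ k, a k * x k - w‖ ≤ r} with hS
  have hSm : MeasurableSet S := measurableSet_le (by fun_prop) (by fun_prop)
  let g : Finset ι → (ι → ℂ × ℂ) → (ι → ℂ) := fun A ω k => if k ∈ A then (ω k).1 else (ω k).2
  have hg : ∀ A, Measurable (g A) := by
    intro A
    refine measurable_pi_iff.2 fun k => ?_
    by_cases hk : k ∈ A <;> simp only [g, hk, if_true, if_false] <;> fun_prop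
  have hSA : ∀ A, (Measure.pi μ).real S = ∫ ω, (g A ⁻¹' S).indicator (fun _ => (1 : ℝ)) ω ∂Q := by
    intro A
    rw [integral_indicator_const _ (hg A hSm), smul_eq_mul, mul_one, ← map_pi_prod_choose μ A,
      map_measureReal_apply (hg A) hSm]
  let h : ι → ℂ × ℂ → ℝ := fun k p => if k ∈ T then (if δ < ‖p.1 - p.2‖ then 1 / 2 else 1) else 1
  have hmeasT : ∀ k, Measurable (h k) := by
    intro k
    by_cases hk : k ∈ T <;> simp only [h, hk, if_true, if_false]
    · exact Measurable.ite (measurableSet_lt (by fun_prop) (by fun_prop)) (by fun_prop) (by fun_prop)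
    · fun_prop
  have hh0 : ∀ k p, 0 ≤ h k p := by intro k p; simp only [h]; split_ifs <;> norm_num
  have hh1 : ∀ k p, h k p ≤ 1 := by intro k p; simp only [h]; split_ifs <;> norm_num
  -- the pointwise Littlewood–Offord bound
  have hpt : ∀ ω : ι → ℂ × ℂ, ∑ A : Finset ι, (g A ⁻¹' S).indicator (fun _ => (1 : ℝ)) ω
      ≤ 2 ^ Fintype.card ι * (2 / √(q + 1) + 2 * 2 ^ q * ∏ k, h k (ω k)) := by
    intro ω
    set N := T.filter fun k => δ < ‖(ω k).1 - (ω k).2‖ with hN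
    have hsum : ∑ A : Finset ι, (g A ⁻¹' S).indicator (fun _ => (1 : ℝ)) ω
        = ((Finset.univ.filter fun A : Finset ι =>
          ‖∑ k ∈ A, a k * ((ω k).1 - (ω k).2) - (w - ∑ k, a k * (ω k).2)‖ ≤ r).card : ℝ) := by
      rw [Finset.card_filter, Nat.cast_sum]
      refine Finset.sum_congr rfl fun A _ => ?_
      have : ∑ k, a k * g A ω k - w
          = ∑ k ∈ A, a k * ((ω k).1 - (ω k).2) - (w - ∑ k, a k * (ω k).2) := by
        have h1 : ∑ k ∈ A, a k * ((ω k).1 - (ω k).2)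
            = ∑ k, if k ∈ A then a k * ((ω k).1 - (ω k).2) else 0 := by simp
        rw [h1, ← sub_add, sub_add_eq_add_sub, ← Finset.sum_add_distrib]
        congr 1
        refine Finset.sum_congr rfl fun k _ => ?_
        simp only [g]
        split_ifs <;> ring
      have hiff : ω ∈ g A ⁻¹' S ↔
          ‖∑ k ∈ A, a k * ((ω k).1 - (ω k).2) - (w - ∑ k, a k * (ω k).2)‖ ≤ r := by
        rw [← this]; exact Iff.rfl
      by_cases hA : ω ∈ g A ⁻¹' S
      · rw [Set.indicator_of_mem hA, if_pos (hiff.1 hA), Nat.cast_one]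
      · rw [Set.indicator_of_notMem hA, if_neg (fun h => hA (hiff.2 h)), Nat.cast_zero]
    rw [hsum]
    refine (card_complexSubsetSum_near_le _ N _ hr ?_).trans ?_
    · intro k hk
      rw [hN, Finset.mem_filter] at hk
      rw [norm_mul]
      exact (ha k hk.1).trans_lt (mul_lt_mul_of_pos_left hk.2 (norm_pos_iff.2 (ha0 k hk.1)))
    · have hprod : ∏ k, h k (ω k) = (1 / 2) ^ N.card := by
        have h2 : ∀ k, h k (ω k) = if k ∈ N then 1 / 2 else 1 := by
          intro k
          simp only [h, hN, Finset.mem_filter]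
          by_cases hk : k ∈ T <;> simp [hk]
        simp only [h2]
        rw [Finset.prod_ite_mem, Finset.univ_inter, Finset.prod_const]
      gcongr
      rw [hprod]
      by_cases hNq : q ≤ N.card
      · have h1 : (2 : ℝ) / √(N.card + 1) ≤ 2 / √(q + 1) := by
          gcongr
        have h2 : (0 : ℝ) ≤ 2 * 2 ^ q * (1 / 2) ^ N.card := by positivity
        linarith
      · push Not at hNq
        have h1 : (2 : ℝ) / √(N.card + 1) ≤ 2 := by
          rw [div_le_iff₀ (by positivity)]
          have : (1 : ℝ) ≤ √(N.card + 1) := by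
            rw [Real.one_le_sqrt]; linarith [Nat.cast_nonneg (α := ℝ) N.card]
          linarith
        have h2 : (1 : ℝ) ≤ 2 ^ q * (1 / 2) ^ N.card := by
          rw [one_div, inv_pow, ← div_eq_mul_inv, one_le_div (by positivity)]
          gcongr
          norm_num
        have h3 : (0 : ℝ) ≤ 2 / √(q + 1) := by positivity
        nlinarith
  have hint : Integrable (fun ω : ι → ℂ × ℂ => ∏ k, h k (ω k)) Q :=
    Integrable.of_bound
      (Finset.measurable_prod _ fun k _ =>
        (hmeasT k).comp (measurable_pi_apply k)).aestronglyMeasurable 1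
      (Eventually.of_forall fun ω => by
        rw [Real.norm_eq_abs, abs_of_nonneg (Finset.prod_nonneg fun k _ => hh0 k _)]
        exact Finset.prod_le_one (fun k _ => hh0 k _) (fun k _ => hh1 k _))
  have hprodint : ∫ ω, ∏ k, h k (ω k) ∂Q ≤ (1 - ε / 2) ^ T.card := by
    rw [hQ, integral_fintype_prod_eq_prod]
    have : ∀ k, ∫ p, h k p ∂((μ k).prod (μ k)) ≤ if k ∈ T then 1 - ε / 2 else 1 := by
      intro k
      by_cases hk : k ∈ T
      · simp only [h, hk, if_true]
        exact (hμ k hk).integral_half_of_far_le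
      · simp [h, hk]
    refine (Finset.prod_le_prod (fun k _ => integral_nonneg (hh0 k)) (fun k _ => this k)).trans ?_
    rw [Finset.prod_ite_mem, Finset.univ_inter, Finset.prod_const]
  have hfin : (2 : ℝ) ^ Fintype.card ι * (Measure.pi μ).real S
      ≤ 2 ^ Fintype.card ι * (2 / √(q + 1) + 2 * 2 ^ q * (1 - ε / 2) ^ T.card) := by
    have h1 : (2 : ℝ) ^ Fintype.card ι * (Measure.pi μ).real S
        = ∫ ω, ∑ A : Finset ι, (g A ⁻¹' S).indicator (fun _ => (1 : ℝ)) ω ∂Q := by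
      rw [integral_finsetSum _ fun A _ => (integrable_const _).indicator (hg A hSm)]
      simp_rw [← hSA]
      simp
    rw [h1]
    refine (integral_mono (integrable_finsetSum _ fun A _ =>
      (integrable_const _).indicator (hg A hSm))
      (((integrable_const _).add (hint.const_mul _)).const_mul _) hpt).trans ?_
    simp only [Pi.add_apply]
    rw [integral_const_mul, integral_add (integrable_const _) (hint.const_mul _),
      integral_const_mul]
    simp only [integral_const, probReal_univ, smul_eq_mul, one_mul]
    gcongr
  exact le_of_mul_le_mul_left hfin (by positivity)

/-! ### Resampling one row given all other entries -/

/-- With half the radius, the spread condition holds for the conditional law at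
almost every value of the conditioning variable. Halving the radius reduces the supremum over all
centres to a countable dense set, so that null sets can be transported to the law of `Y`. -/
lemma ae_map_isSpreadLaw_condDistrib {Ω₀ : Type*} [MeasurableSpace Ω₀] {P₀ : Measure Ω₀}
    [IsProbabilityMeasure P₀] {X Y : Ω₀ → ℂ} (hY : Measurable Y) {ε δ : ℝ} (hδ : 0 < δ)
    (hε : ε ≤ 1)
    (h : ∀ᵐ ω ∂P₀, (⨆ z : ℂ, condDistrib X Y P₀ (Y ω) (Metric.closedBall z δ))
      ≤ ENNReal.ofReal (1 - ε)) :
    ∀ᵐ y ∂(P₀.map Y), IsSpreadLaw ε (δ / 2) (condDistrib X Y P₀ y) := by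
  have h1 : ∀ᵐ y ∂(P₀.map Y), ∀ k : ℕ, condDistrib X Y P₀ y
      (Metric.closedBall (TopologicalSpace.denseSeq ℂ k) δ) ≤ ENNReal.ofReal (1 - ε) := by
    rw [ae_all_iff]
    intro k
    rw [ae_map_iff hY.aemeasurable
      (measurableSet_le (Kernel.measurable_coe _ measurableSet_closedBall) measurable_const)]
    filter_upwards [h] with ω hω
    exact (le_iSup (fun z : ℂ => condDistrib X Y P₀ (Y ω) (Metric.closedBall z δ)) _).trans hω
  filter_upwards [h1] with y hy w
  obtain ⟨k, hk⟩ := (TopologicalSpace.denseRange_denseSeq ℂ).exists_dist_lt w (half_pos hδ)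
  refine ENNReal.toReal_le_of_le_ofReal (by linarith) ((measure_mono ?_).trans (hy k))
  exact Metric.closedBall_subset_closedBall' (by linarith)

/-- Both conditional laws of the atom vector are spread, at almost every value of the other
coordinate. -/
structure IsCondSpreadLaw {Ω₀ : Type*} [MeasurableSpace Ω₀] (P₀ : Measure Ω₀) [IsFiniteMeasure P₀]
    (ξ₁ ξ₂ : Ω₀ → ℂ) (ε δ : ℝ) : Prop where
  left : ∀ᵐ y ∂(P₀.map ξ₂), IsSpreadLaw ε δ (condDistrib ξ₁ ξ₂ P₀ y)
  right : ∀ᵐ y ∂(P₀.map ξ₁), IsSpreadLaw ε δ (condDistrib ξ₂ ξ₁ P₀ y)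

lemma IsConditionallySpread.exists_isCondSpreadLaw {Ω₀ : Type*} [MeasurableSpace Ω₀]
    {P₀ : Measure Ω₀} [IsProbabilityMeasure P₀] {ξ₁ ξ₂ : Ω₀ → ℂ} (hξ₁ : Measurable ξ₁)
    (hξ₂ : Measurable ξ₂) (h : IsConditionallySpread P₀ ξ₁ ξ₂) :
    ∃ ε δ : ℝ, 0 < ε ∧ ε ≤ 1 / 2 ∧ 0 < δ ∧ IsCondSpreadLaw P₀ ξ₁ ξ₂ ε δ := by
  obtain ⟨ε₀, δ₀, hε, hδ, h⟩ := h
  have hle : ENNReal.ofReal (1 - ε₀) ≤ ENNReal.ofReal (1 - min ε₀ (1 / 2)) :=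
    ENNReal.ofReal_le_ofReal (by linarith [min_le_left ε₀ (1 / 2)])
  have h1 : min ε₀ (1 / 2) ≤ 1 := (min_le_right _ _).trans (by norm_num)
  refine ⟨min ε₀ (1 / 2), δ₀ / 2, by positivity, min_le_right _ _, by positivity, ?_, ?_⟩
  · exact ae_map_isSpreadLaw_condDistrib hξ₂ hδ h1 (h.mono fun ω hω => hω.1.trans hle)
  · exact ae_map_isSpreadLaw_condDistrib hξ₁ hδ h1 (h.mono fun ω hω => hω.2.trans hle)

/-- The joint law of `(X, Y)` is realised by drawing `Y` and then `X` as a function of `Y` and an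
independent uniform variable. -/
lemma exists_noise_representation {Ω₀ : Type*} [MeasurableSpace Ω₀] (P₀ : Measure Ω₀)
    [IsProbabilityMeasure P₀] {X Y : Ω₀ → ℂ} (hX : Measurable X) (hY : Measurable Y) :
    ∃ f : ℂ → unitInterval → ℂ, Measurable (Function.uncurry f) ∧
      (∀ y, (volume : Measure unitInterval).map (f y) = condDistrib X Y P₀ y) ∧
      ((P₀.map Y).prod (volume : Measure unitInterval)).map (fun p => (f p.1 p.2, p.1))
        = P₀.map (fun ω => (X ω, Y ω)) := by
  obtain ⟨f, hf, hfm⟩ := Kernel.exists_measurable_map_eq_unitInterval (condDistrib X Y P₀)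
  have := Measure.isProbabilityMeasure_map (μ := P₀) hY.aemeasurable
  refine ⟨f, hf, hfm, ?_⟩
  have hmf : Measurable fun p : ℂ × unitInterval => (f p.1 p.2, p.1) :=
    hf.prodMk measurable_fst
  have h1 : P₀.map (fun ω => (X ω, Y ω)) = ((P₀.map Y) ⊗ₘ condDistrib X Y P₀).map Prod.swap := by
    rw [compProd_map_condDistrib hX.aemeasurable, Measure.map_map measurable_swap (by fun_prop)]
    rfl
  rw [h1]
  ext s hs
  rw [Measure.map_apply hmf hs, Measure.map_apply measurable_swap hs,
    Measure.prod_apply (hmf hs), Measure.compProd_apply (measurable_swap hs)]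
  refine lintegral_congr fun y => ?_
  rw [← hfm y, Measure.map_apply hf.of_uncurry_left
    (measurable_prodMk_left (measurable_swap hs))]
  rfl

/-- Independence of row and column `i` from the other entries, and of the pairs forming them. -/
lemma IsEllipticMatrix.map_rowPairs_prod {Ω₀ : Type*} [MeasurableSpace Ω₀] {P₀ : Measure Ω₀}
    {ξ₁ ξ₂ : Ω₀ → ℂ} {Ω : Type*} [MeasurableSpace Ω] {P : Measure Ω} [IsProbabilityMeasure P]
    {n : ℕ} {X : Ω → Matrix (Fin n) (Fin n) ℂ} (h : IsEllipticMatrix P₀ ξ₁ ξ₂ P X) (i : Fin n) :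
    P.map (fun ω => ((fun k => (X ω i k, X ω k i) : Fin n → ℂ × ℂ),
        (fun a b => if a = i ∨ b = i then 0 else X ω a b : Fin n → Fin n → ℂ)))
      = (Measure.pi fun k => P.map fun ω => (X ω i k, X ω k i)).prod
        (P.map (fun ω => (fun a b => if a = i ∨ b = i then 0 else X ω a b :
          Fin n → Fin n → ℂ))) := by
  classical
  have hm := h.measurable_entry
  let f : (p : {p : Fin n × Fin n // p.1 ≤ p.2}) → Ω → ℂ × ℂ :=
    fun p ω => (X ω p.1.1 p.1.2, X ω p.1.2 p.1.1)
  have hf : ∀ p, Measurable (f p) := fun p => (hm _ _).prodMk (hm _ _)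
  let g : Fin n → {p : Fin n × Fin n // p.1 ≤ p.2} :=
    fun k => if hk : i ≤ k then ⟨(i, k), hk⟩ else ⟨(k, i), (not_le.1 hk).le⟩
  have hg : Function.Injective g := by
    intro k k' hkk
    simp only [g] at hkk
    split_ifs at hkk with h1 h2 h2 <;> simp only [Subtype.mk.injEq, Prod.mk.injEq] at hkk
    · exact hkk.2
    · exact absurd (hkk.1 ▸ le_rfl) h2
    · exact absurd hkk.1 (by rintro rfl; exact h1 le_rfl)
    · exact hkk.1
  let sw : Fin n → ℂ × ℂ → ℂ × ℂ := fun k => if i ≤ k then id else Prod.swap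
  have hsw : ∀ k, Measurable (sw k) := by
    intro k
    by_cases hk : i ≤ k
    · simp only [sw, hk, if_true]; exact measurable_id
    · simp only [sw, hk, if_false]; exact measurable_swap
  have hV : ∀ k ω, (X ω i k, X ω k i) = sw k (f (g k) ω) := by
    intro k ω
    by_cases hk : i ≤ k <;> simp [sw, g, f, hk]
  have hindV : iIndepFun (fun k ω => (X ω i k, X ω k i)) P := by
    have := (h.indep.precomp hg).comp sw hsw
    refine this.congr fun k => ?_
    exact Eventually.of_forall fun ω => (hV k ω).symm
  have hVm : ∀ k, Measurable fun ω => (X ω i k, X ω k i) := fun k => (hm _ _).prodMk (hm _ _)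
  have hOm : Measurable (fun ω => (fun a b => if a = i ∨ b = i then 0 else X ω a b :
      Fin n → Fin n → ℂ)) := by
    refine measurable_pi_iff.2 fun a => measurable_pi_iff.2 fun b => ?_
    split_ifs
    · exact measurable_const
    · exact hm a b
  have hindO : IndepFun (fun ω => (fun k => (X ω i k, X ω k i) : Fin n → ℂ × ℂ))
      (fun ω => (fun a b => if a = i ∨ b = i then 0 else X ω a b : Fin n → Fin n → ℂ)) P := by
    let S := Finset.univ.image g
    have hST := h.indep.indepFun_finset S Sᶜ disjoint_compl_right hf
    let φ : (S → ℂ × ℂ) → (Fin n → ℂ × ℂ) :=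
      fun u k => sw k (u ⟨g k, Finset.mem_image_of_mem g (Finset.mem_univ k)⟩)
    have hφ : Measurable φ :=
      measurable_pi_iff.2 fun k => (hsw k).comp (measurable_pi_apply _)
    have hmem : ∀ a b : Fin n, ¬ (a = i ∨ b = i) → ∀ hab : a ≤ b,
        (⟨(a, b), hab⟩ : {p : Fin n × Fin n // p.1 ≤ p.2}) ∈ Sᶜ := by
      intro a b hne hab
      simp only [S, Finset.mem_compl, Finset.mem_image, Finset.mem_univ, true_and, not_exists]
      intro k hk
      simp only [g] at hk
      split_ifs at hk <;> simp only [Subtype.mk.injEq, Prod.mk.injEq] at hk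
      · exact hne (Or.inl hk.1.symm)
      · exact hne (Or.inr hk.2.symm)
    let ψ : ((Sᶜ : Finset _) → ℂ × ℂ) → (Fin n → Fin n → ℂ) := fun t a b =>
      if hne : a = i ∨ b = i then 0
      else if hab : a ≤ b then (t ⟨⟨(a, b), hab⟩, hmem a b hne hab⟩).1
      else (t ⟨⟨(b, a), (not_le.1 hab).le⟩, hmem b a (fun h' => hne h'.symm) _⟩).2
    have hψ : Measurable ψ := by
      refine measurable_pi_iff.2 fun a => measurable_pi_iff.2 fun b => ?_
      simp only [ψ]
      split_ifs
      · exact measurable_const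
      · exact measurable_fst.comp (measurable_pi_apply _)
      · exact measurable_snd.comp (measurable_pi_apply _)
    have := hST.comp hφ hψ
    convert! this using 1
    · ext1 ω
      ext1 k
      exact hV k ω
    · ext1 ω
      ext a b
      simp only [Function.comp, ψ]
      split_ifs <;> rfl
  rw [hindO.map_prod_eq_prod_map_map (measurable_pi_iff.2 hVm).aemeasurable hOm.aemeasurable,
    hindV.map_fun_eq_pi_map fun k => (hVm k).aemeasurable]

/-- Resampling principle. To bound the probability of an event it suffices to bound, for every
fixed matrix `A`, the probability of the event after replacing row `i` of `A` by independent entries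
with arbitrary laws that are spread off the diagonal: these are the conditional laws of row `i`
given all the other entries, the correlated column `i` included. -/
theorem IsEllipticMatrix.measure_le_of_forall_update {Ω₀ : Type*} [MeasurableSpace Ω₀]
    {P₀ : Measure Ω₀} [IsProbabilityMeasure P₀] {ξ₁ ξ₂ : Ω₀ → ℂ} (hξ₁ : Measurable ξ₁)
    (hξ₂ : Measurable ξ₂) {ε δ : ℝ} (hs : IsCondSpreadLaw P₀ ξ₁ ξ₂ ε δ)
    {Ω : Type*} [MeasurableSpace Ω] {P : Measure Ω} [IsProbabilityMeasure P]
    {n : ℕ} {X : Ω → Matrix (Fin n) (Fin n) ℂ} (h : IsEllipticMatrix P₀ ξ₁ ξ₂ P X) (i : Fin n)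
    {B : Set (Fin n → Fin n → ℂ)} (hB : MeasurableSet B) (q : ENNReal)
    (H : ∀ (A : Fin n → Fin n → ℂ) (μ : Fin n → Measure ℂ), (∀ k, IsProbabilityMeasure (μ k)) →
      (∀ k, k ≠ i → IsSpreadLaw ε δ (μ k)) →
      Measure.pi μ {x | Function.update A i x ∈ B} ≤ q) :
    P {ω | (fun a b => X ω a b) ∈ B} ≤ q := by
  have hm := h.measurable_entry
  have hVm : ∀ k, Measurable fun ω => (X ω i k, X ω k i) := fun k => (hm _ _).prodMk (hm _ _)
  -- each pair is a function of the column entry and of independent noise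
  have hrep : ∀ k, ∃ (m : Measure ℂ) (f : ℂ → unitInterval → ℂ), IsProbabilityMeasure m ∧
      Measurable (Function.uncurry f) ∧
      (k ≠ i → ∀ᵐ y ∂m, IsSpreadLaw ε δ ((volume : Measure unitInterval).map (f y))) ∧
      (m.prod (volume : Measure unitInterval)).map (fun p => (f p.1 p.2, p.1))
        = P.map (fun ω => (X ω i k, X ω k i)) := by
    intro k
    rcases lt_trichotomy i k with hk | rfl | hk
    · obtain ⟨f, hf, hf1, hf2⟩ := exists_noise_representation P₀ hξ₁ hξ₂
      refine ⟨P₀.map ξ₂, f, Measure.isProbabilityMeasure_map hξ₂.aemeasurable, hf, ?_, ?_⟩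
      · intro _
        filter_upwards [hs.left] with y hy
        rwa [hf1]
      · rw [hf2, (h.identDistrib i k hk).map_eq]
    · obtain ⟨f, hf, hf1, hf2⟩ := exists_noise_representation P (hm i i) (hm i i)
      exact ⟨_, f, Measure.isProbabilityMeasure_map (hm i i).aemeasurable, hf,
        fun h' => absurd rfl h', hf2⟩
    · obtain ⟨f, hf, hf1, hf2⟩ := exists_noise_representation P₀ hξ₂ hξ₁
      refine ⟨P₀.map ξ₁, f, Measure.isProbabilityMeasure_map hξ₁.aemeasurable, hf, ?_, ?_⟩
      · intro _
        filter_upwards [hs.right] with y hy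
        rwa [hf1]
      · rw [hf2]
        have h1 := (h.identDistrib k i hk).map_eq
        have h2 : P₀.map (fun ω => (ξ₂ ω, ξ₁ ω))
            = (P₀.map fun ω => (ξ₁ ω, ξ₂ ω)).map Prod.swap := by
          rw [Measure.map_map measurable_swap (by fun_prop)]; rfl
        have h3 : P.map (fun ω => (X ω i k, X ω k i))
            = (P.map fun ω => (X ω k i, X ω i k)).map Prod.swap := by
          rw [Measure.map_map measurable_swap ((hm _ _).prodMk (hm _ _))]; rfl
        rw [h2, h3, h1]
  choose m f hmp hf hspread hmap using hrep
  set O : Ω → (Fin n → Fin n → ℂ) := fun ω a b => if a = i ∨ b = i then 0 else X ω a b with hO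
  have hOm : Measurable O := by
    refine measurable_pi_iff.2 fun a => measurable_pi_iff.2 fun b => ?_
    simp only [hO]
    split_ifs
    · exact measurable_const
    · exact hm a b
  let Ψ : (Fin n → ℂ × ℂ) × (Fin n → Fin n → ℂ) → (Fin n → Fin n → ℂ) := fun p a b =>
    if a = i then (p.1 b).1 else if b = i then (p.1 a).2 else p.2 a b
  have hΨ : Measurable Ψ := by
    refine measurable_pi_iff.2 fun a => measurable_pi_iff.2 fun b => ?_
    simp only [Ψ]
    split_ifs <;> fun_prop
  have hX : ∀ ω, (fun a b => X ω a b) = Ψ ((fun k => (X ω i k, X ω k i)), O ω) := by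
    intro ω
    ext a b
    by_cases ha : a = i
    · simp [Ψ, ha]
    · by_cases hb : b = i <;> simp [Ψ, ha, hb, hO]
  have hjoint := h.map_rowPairs_prod i
  have hVOm : Measurable fun ω => ((fun k => (X ω i k, X ω k i) : Fin n → ℂ × ℂ), O ω) :=
    (measurable_pi_iff.2 hVm).prodMk hOm
  have hP : P {ω | (fun a b => X ω a b) ∈ B}
      = ((Measure.pi fun k => P.map fun ω => (X ω i k, X ω k i)).prod (P.map O)) (Ψ ⁻¹' B) := by
    rw [← hjoint, Measure.map_apply hVOm (hΨ hB)]
    congr 1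
    ext ω
    simp only [Set.mem_ofPred_eq, Set.mem_preimage]
    rw [hX ω]
  have hOp : IsProbabilityMeasure (P.map O) := Measure.isProbabilityMeasure_map hOm.aemeasurable
  have hVp : ∀ k, IsProbabilityMeasure (P.map fun ω => (X ω i k, X ω k i)) :=
    fun k => Measure.isProbabilityMeasure_map (hVm k).aemeasurable
  let F : (Fin n → ℂ) × (Fin n → unitInterval) → (Fin n → ℂ × ℂ) :=
    fun p k => (f k (p.1 k) (p.2 k), p.1 k)
  have hF : Measurable F := by
    refine measurable_pi_iff.2 fun k => Measurable.prodMk ?_ (by fun_prop)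
    exact (hf k).comp (Measurable.prodMk (f := fun p : (Fin n → ℂ) × (Fin n → unitInterval) => p.1 k)
      (by fun_prop) (by fun_prop))
  have hmf : ∀ k, Measurable fun p : ℂ × unitInterval => (f k p.1 p.2, p.1) :=
    fun k => (hf k).prodMk measurable_fst
  have hpi : (Measure.pi fun k => P.map fun ω => (X ω i k, X ω k i))
      = ((Measure.pi m).prod (Measure.pi fun _ => (volume : Measure unitInterval))).map F := by
    rw [← (measurePreserving_arrowProdEquivProdArrow ℂ unitInterval (Fin n) m
      (fun _ => volume)).map_eq, Measure.map_map hF (MeasurableEquiv.measurable _)]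
    simp_rw [← hmap]
    have : ∀ k, IsProbabilityMeasure ((m k |>.prod (volume : Measure unitInterval)).map
      (fun p => (f k p.1 p.2, p.1))) := fun k => by rw [hmap k]; exact hVp k
    rw [← Measure.pi_map_pi fun k => (hmf k).aemeasurable]
    rfl
  have hae : ∀ᵐ y ∂(Measure.pi m), ∀ k, k ≠ i →
      IsSpreadLaw ε δ ((volume : Measure unitInterval).map (f k (y k))) := by
    rw [ae_all_iff]
    intro k
    by_cases hk : k = i
    · exact Eventually.of_forall fun y h' => absurd hk h'
    · filter_upwards [Measure.tendsto_eval_ae_ae.eventually (hspread k hk)] with y hy _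
      exact hy
  rw [hP, Measure.prod_apply_symm (hΨ hB)]
  calc ∫⁻ o, (Measure.pi fun k => P.map fun ω => (X ω i k, X ω k i))
        ((fun x => (x, o)) ⁻¹' (Ψ ⁻¹' B)) ∂(P.map O)
      ≤ ∫⁻ _, q ∂(P.map O) := by
        refine lintegral_mono fun o => ?_
        have hmo : MeasurableSet ((fun x => (x, o)) ⁻¹' (Ψ ⁻¹' B)) :=
          measurable_prodMk_right (hΨ hB)
        rw [hpi, Measure.map_apply hF hmo, Measure.prod_apply (hF hmo)]
        calc _ ≤ ∫⁻ _, q ∂(Measure.pi m) := by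
              refine lintegral_mono_ae ?_
              filter_upwards [hae] with y hy
              have hfy : ∀ k, Measurable (f k (y k)) := fun k => (hf k).of_uncurry_left
              have hpr : ∀ k, IsProbabilityMeasure
                  ((volume : Measure unitInterval).map (f k (y k))) :=
                fun k => Measure.isProbabilityMeasure_map (hfy k).aemeasurable
              refine le_trans (le_of_eq ?_)
                (H (Ψ ((fun k => (0, y k)), o)) _ hpr hy)
              rw [← Measure.pi_map_pi fun k => (hfy k).aemeasurable, Measure.map_apply]
              · congr 1
                ext s
                simp only [Set.mem_preimage, Set.mem_ofPred_eq, F]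
                have : Ψ ((fun k => (f k (y k) (s k), y k)), o) = Function.update
                    (Ψ ((fun k => (0, y k)), o)) i (fun k => f k (y k) (s k)) := by
                  ext a b
                  by_cases ha : a = i
                  · subst ha; simp [Ψ]
                  · simp [Ψ, ha]
                rw [this]
              · exact measurable_pi_iff.2 fun k => (hfy k).comp (measurable_pi_apply k)
              · exact (measurable_update' (a := i) |>.comp measurable_prodMk_left) hB
          _ = q := by simp
    _ = q := by simp

lemma IsCondSpreadLaw.symm {Ω₀ : Type*} [MeasurableSpace Ω₀] {P₀ : Measure Ω₀}
    [IsFiniteMeasure P₀] {ξ₁ ξ₂ : Ω₀ → ℂ} {ε δ : ℝ} (hs : IsCondSpreadLaw P₀ ξ₁ ξ₂ ε δ) :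
    IsCondSpreadLaw P₀ ξ₂ ξ₁ ε δ :=
  ⟨hs.right, hs.left⟩

lemma IsEllipticMatrix.transpose {Ω₀ : Type*} [MeasurableSpace Ω₀] {P₀ : Measure Ω₀}
    {ξ₁ ξ₂ : Ω₀ → ℂ} {Ω : Type*} [MeasurableSpace Ω] {P : Measure Ω}
    {n : ℕ} {X : Ω → Matrix (Fin n) (Fin n) ℂ} (h : IsEllipticMatrix P₀ ξ₁ ξ₂ P X) :
    IsEllipticMatrix P₀ ξ₂ ξ₁ P fun ω => (X ω).transpose where
  measurable_entry i j := h.measurable_entry j i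
  indep := h.indep.comp (fun _ => Prod.swap) fun _ => measurable_swap
  identDistrib i j hij := (h.identDistrib i j hij).comp measurable_swap

/-! ### Approximate null vectors of small support -/

/-- The event that some vector with coefficients in the finite set `G`, supported on `m`
coordinates and nonzero at one of them, is mapped by `Y`, on all columns outside its support with
one exception, to within `δ` times that coefficient of a constant `s * w`, `w ∈ G`. -/
def sparseNetEvent {n : ℕ} (m : ℕ) (G : Finset ℂ) (s : ℂ) (δ : ℝ) : Set (Fin n → Fin n → ℂ) :=
  {Y | ∃ f : Fin m → Fin n, Function.Injective f ∧ ∃ g : Fin m → G, ∃ w : G, ∃ a₀ : Fin m,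
    ∃ i : Fin n, (g a₀ : ℂ) ≠ 0 ∧
      ∀ j, j ∉ Set.range f → j ≠ i → ‖∑ a, Y (f a) j * g a - s * w‖ ≤ δ * ‖(g a₀ : ℂ)‖}

lemma IsSpreadLaw.measure_closedBall_le {ε δ : ℝ} {μ : Measure ℂ} [IsFiniteMeasure μ]
    (h : IsSpreadLaw ε δ μ) (w : ℂ) : μ (Metric.closedBall w δ) ≤ ENNReal.ofReal (1 - ε) := by
  rw [← ofReal_measureReal]
  exact ENNReal.ofReal_le_ofReal (h w)

/-- For a fixed sparse vector, resampling the row of `Y` at a nonzero coefficient makes the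
conditions on the different columns independent, each of probability at most `1 - ε`. -/
lemma IsEllipticMatrix.measure_sparse_le {Ω₀ : Type*} [MeasurableSpace Ω₀]
    {P₀ : Measure Ω₀} [IsProbabilityMeasure P₀] {ξ₁ ξ₂ : Ω₀ → ℂ} (hξ₁ : Measurable ξ₁)
    (hξ₂ : Measurable ξ₂) {ε δ : ℝ} (hε : 0 ≤ ε) (hs : IsCondSpreadLaw P₀ ξ₁ ξ₂ ε δ)
    {Ω : Type*} [MeasurableSpace Ω] {P : Measure Ω} [IsProbabilityMeasure P]
    {n : ℕ} {Y : Ω → Matrix (Fin n) (Fin n) ℂ} (h : IsEllipticMatrix P₀ ξ₁ ξ₂ P Y)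
    {m : ℕ} (f : Fin m → Fin n) (hf : Function.Injective f) (g : Fin m → ℂ) (c : ℂ) (a₀ : Fin m)
    (hg : g a₀ ≠ 0) (i : Fin n) :
    P {ω | ∀ j, j ∉ Set.range f → j ≠ i → ‖∑ a, Y ω (f a) j * g a - c‖ ≤ δ * ‖g a₀‖}
      ≤ ENNReal.ofReal (1 - ε) ^ (n - m - 1) := by
  classical
  set B : Set (Fin n → Fin n → ℂ) :=
    {Z | ∀ j, j ∉ Set.range f → j ≠ i → ‖∑ a, Z (f a) j * g a - c‖ ≤ δ * ‖g a₀‖} with hB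
  have hBm : MeasurableSet B := by
    simp only [hB, Set.ofPred_forall]
    refine MeasurableSet.iInter fun j => MeasurableSet.iInter fun _ => MeasurableSet.iInter fun _ =>
      measurableSet_le (by fun_prop) (by fun_prop)
  refine h.measure_le_of_forall_update hξ₁ hξ₂ hs (f a₀) hBm _ ?_
  intro A μ hμ hspread
  set J : Finset (Fin n) := Finset.univ.filter fun j => j ∉ Set.range f ∧ j ≠ i with hJ
  have hJcard : n - m - 1 ≤ J.card := by
    have hJc : Jᶜ ⊆ Finset.univ.image f ∪ {i} := by
      intro j hj
      simp only [hJ, Finset.mem_compl, Finset.mem_filter, Finset.mem_univ, true_and, not_and,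
        not_not, Set.mem_range] at hj
      simp only [Finset.mem_union, Finset.mem_image, Finset.mem_univ, true_and,
        Finset.mem_singleton]
      by_cases hjf : ∃ y, f y = j
      · exact Or.inl hjf
      · exact Or.inr (hj hjf)
    have h1 := (Finset.card_le_card hJc).trans (Finset.card_union_le _ _)
    have h2 : (Finset.univ.image f).card ≤ m := by
      simpa using Finset.card_image_le (s := Finset.univ) (f := f)
    rw [Finset.card_compl, Fintype.card_fin, Finset.card_singleton] at h1
    omega
  let C : Fin n → ℂ := fun j => ∑ a ∈ Finset.univ.erase a₀, A (f a) j * g a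
  have hsub : {x | Function.update A (f a₀) x ∈ B} ⊆ Set.univ.pi fun j =>
      if j ∈ J then Metric.closedBall ((c - C j) / g a₀) δ else Set.univ := by
    intro x hx j _
    by_cases hj : j ∈ J
    · simp only [hj, if_true]
      have hj' := (Finset.mem_filter.1 hj).2
      have hxj := hx j hj'.1 hj'.2
      have hsum : ∑ a, Function.update A (f a₀) x (f a) j * g a = x j * g a₀ + C j := by
        rw [← Finset.add_sum_erase _ _ (Finset.mem_univ a₀)]
        congr 1
        · simp
        · refine Finset.sum_congr rfl fun a ha => ?_
          rw [Function.update_of_ne (hf.ne (Finset.ne_of_mem_erase ha))]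
      rw [hsum] at hxj
      rw [Metric.mem_closedBall, dist_eq_norm]
      have h1 : x j - (c - C j) / g a₀ = (x j * g a₀ + C j - c) / g a₀ := by
        field_simp
        ring
      rw [h1, norm_div, div_le_iff₀ (norm_pos_iff.2 hg)]
      exact hxj
    · simp [hj]
  refine (measure_mono hsub).trans ?_
  rw [Measure.pi_pi]
  have hfac : ∀ j, μ j (if j ∈ J then Metric.closedBall ((c - C j) / g a₀) δ else Set.univ)
      ≤ if j ∈ J then ENNReal.ofReal (1 - ε) else 1 := by
    intro j
    by_cases hj : j ∈ J
    · simp only [hj, if_true]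
      have hj' := (Finset.mem_filter.1 hj).2
      exact (hspread j fun h' => hj'.1 ⟨a₀, h'.symm⟩).measure_closedBall_le _
    · simp [hj]
  refine (Finset.prod_le_prod' fun j _ => hfac j).trans ?_
  rw [Finset.prod_ite_mem, Finset.univ_inter, Finset.prod_const]
  refine pow_le_pow_right_of_le_one' ?_ hJcard
  rw [ENNReal.ofReal_le_one]
  linarith

theorem IsEllipticMatrix.measure_sparseNetEvent_le {Ω₀ : Type*} [MeasurableSpace Ω₀]
    {P₀ : Measure Ω₀} [IsProbabilityMeasure P₀] {ξ₁ ξ₂ : Ω₀ → ℂ} (hξ₁ : Measurable ξ₁)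
    (hξ₂ : Measurable ξ₂) {ε δ : ℝ} (hε : 0 ≤ ε) (hs : IsCondSpreadLaw P₀ ξ₁ ξ₂ ε δ)
    {Ω : Type*} [MeasurableSpace Ω] {P : Measure Ω} [IsProbabilityMeasure P]
    {n : ℕ} {Y : Ω → Matrix (Fin n) (Fin n) ℂ} (h : IsEllipticMatrix P₀ ξ₁ ξ₂ P Y)
    (m : ℕ) (G : Finset ℂ) (s : ℂ) :
    P {ω | (fun a b => Y ω a b) ∈ sparseNetEvent m G s δ}
      ≤ ((n ^ m * (G.card ^ m * (G.card * (m * n))) : ℕ) : ENNReal)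
        * ENNReal.ofReal (1 - ε) ^ (n - m - 1) := by
  classical
  let E : (Fin m → Fin n) × (Fin m → G) × G × Fin m × Fin n → Set Ω := fun t =>
    {ω | Function.Injective t.1 ∧ (t.2.1 t.2.2.2.1 : ℂ) ≠ 0 ∧
      ∀ j, j ∉ Set.range t.1 → j ≠ t.2.2.2.2 →
        ‖∑ a, Y ω (t.1 a) j * t.2.1 a - s * t.2.2.1‖ ≤ δ * ‖(t.2.1 t.2.2.2.1 : ℂ)‖}
  have hsub : {ω | (fun a b => Y ω a b) ∈ sparseNetEvent m G s δ} ⊆ ⋃ t, E t := by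
    rintro ω ⟨f, hf, g, w, a₀, i, hg, hj⟩
    exact Set.mem_iUnion.2 ⟨(f, g, w, a₀, i), hf, hg, hj⟩
  have hE : ∀ t, P (E t) ≤ ENNReal.ofReal (1 - ε) ^ (n - m - 1) := by
    rintro ⟨f, g, w, a₀, i⟩
    by_cases hfg : Function.Injective f ∧ (g a₀ : ℂ) ≠ 0
    · refine (measure_mono ?_).trans (h.measure_sparse_le hξ₁ hξ₂ hε hs f hfg.1
        (fun a => (g a : ℂ)) (s * w) a₀ hfg.2 i)
      exact fun ω hω => hω.2.2
    · have : E (f, g, w, a₀, i) = ∅ := by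
        ext ω
        simp only [Set.mem_empty_iff_false, iff_false]
        exact fun hω => hfg ⟨hω.1, hω.2.1⟩
      rw [this, measure_empty]
      exact zero_le
  refine (measure_mono hsub).trans ((measure_iUnion_fintype_le P E).trans ?_)
  refine (Finset.sum_le_card_nsmul _ _ _ fun t _ => hE t).trans (le_of_eq ?_)
  rw [nsmul_eq_mul, Finset.card_univ]
  simp [Fintype.card_prod]

/-- A grid of mesh `1 / Q`. -/
lemma exists_finset_net_closedBall (Q : ℕ) (hQ : 0 < Q) :
    ∃ G : Finset ℂ, G.card ≤ 49 * Q ^ 2 ∧ ∀ x : ℂ, ‖x‖ ≤ 2 → ∃ g ∈ G, ‖x - g‖ ≤ 2 / Q := by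
  classical
  have hQ' : (0 : ℝ) < Q := by exact_mod_cast hQ
  let I : Finset ℤ := Finset.Icc (-(3 * Q)) (3 * Q)
  let φ : ℤ × ℤ → ℂ := fun p => ⟨p.1 / Q, p.2 / Q⟩
  refine ⟨(I ×ˢ I).image φ, ?_, ?_⟩
  · refine Finset.card_image_le.trans ?_
    rw [Finset.card_product, Int.card_Icc]
    have h1 : (3 * (Q : ℤ) + 1 - -(3 * Q)).toNat ≤ 7 * Q := by omega
    calc _ ≤ (7 * Q) * (7 * Q) := Nat.mul_le_mul h1 h1
      _ = 49 * Q ^ 2 := by ring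
  · intro x hx
    have key : ∀ t : ℝ, |t| ≤ 2 → ⌊t * Q⌋ ∈ I ∧ |t - ⌊t * Q⌋ / Q| ≤ 1 / Q := by
      intro t ht
      rw [abs_le] at ht
      have h1 := Int.floor_le (t * Q)
      have h2 := Int.lt_floor_add_one (t * Q)
      have hQ1 : (1 : ℝ) ≤ Q := by exact_mod_cast hQ
      refine ⟨Finset.mem_Icc.2 ⟨?_, ?_⟩, ?_⟩
      · have : (-(3 * Q) : ℝ) < ⌊t * Q⌋ + 1 := by nlinarith
        have : (-(3 * Q) : ℤ) < ⌊t * Q⌋ + 1 := by exact_mod_cast this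
        omega
      · have : (⌊t * Q⌋ : ℝ) ≤ 3 * Q := by nlinarith
        exact_mod_cast this
      · have h3 : t - ⌊t * Q⌋ / Q = (t * Q - ⌊t * Q⌋) / Q := by field_simp
        rw [h3, abs_div, abs_of_pos hQ', abs_of_nonneg (by linarith)]
        gcongr
        linarith
    obtain ⟨h1, h2⟩ := key x.re ((Complex.abs_re_le_norm x).trans hx)
    obtain ⟨h3, h4⟩ := key x.im ((Complex.abs_im_le_norm x).trans hx)
    refine ⟨φ (⌊x.re * Q⌋, ⌊x.im * Q⌋), Finset.mem_image_of_mem _ (Finset.mk_mem_product h1 h3), ?_⟩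
    refine (Complex.norm_le_abs_re_add_abs_im _).trans ?_
    simp only [φ, Complex.sub_re, Complex.sub_im]
    calc _ ≤ 1 / (Q : ℝ) + 1 / Q := add_le_add h2 h4
      _ = 2 / Q := by ring

/-- Rounding: an approximate null vector `v` that is small off a set of `m` coordinates, but not
everywhere, puts `Y` into the net event. -/
lemma mem_sparseNetEvent_of_sparse {n m : ℕ} (hmn : m ≤ n) {G : Finset ℂ} {s : ℂ}
    {δ K ρ η κ β : ℝ} (hδ : 0 ≤ δ) (hK : 0 ≤ K) (hρ : 0 ≤ ρ) (hηκ : η < κ) (hρκ : ρ < κ)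
    (hG : ∀ x : ℂ, ‖x‖ ≤ 2 → ∃ g ∈ G, ‖x - g‖ ≤ η)
    {Y : Fin n → Fin n → ℂ} (hY : ∀ a b, ‖Y a b‖ ≤ K) (v : Fin n → ℂ) (w : ℂ) (i : Fin n)
    (hv : ∀ k, ‖v k‖ ≤ 2) (hw : ‖w‖ ≤ 2) (S : Finset (Fin n)) (hS : S.card ≤ m)
    (hvS : ∀ k, k ∉ S → ‖v k‖ ≤ ρ) (k₀ : Fin n) (hk₀ : κ ≤ ‖v k₀‖)
    (hsum : ∀ j, j ≠ i → ‖v j‖ ≤ ρ → ‖∑ k, Y k j * v k - s * w‖ ≤ β)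
    (hbound : β + n * K * ρ + m * K * η + ‖s‖ * η ≤ δ * (κ - η)) :
    Y ∈ sparseNetEvent m G s δ := by
  classical
  obtain ⟨S', hSS', hS'⟩ := Finset.exists_superset_card_eq hS (by simpa using hmn)
  let f : Fin m → Fin n := S'.orderEmbOfFin hS'
  have hf : Function.Injective f := (S'.orderEmbOfFin hS').injective
  have hfr : ∀ k, k ∈ Set.range f ↔ k ∈ S' := by
    intro k
    have := S'.range_orderEmbOfFin hS'
    rw [show Set.range f = (S' : Set (Fin n)) from this, Finset.mem_coe]
  have himg : Finset.univ.image f = S' := by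
    ext k
    rw [← hfr k]
    simp
  choose γ hγG hγ using hG
  let g : Fin m → G := fun a => ⟨γ (v (f a)) (hv _), hγG _ _⟩
  have hgv : ∀ a, ‖v (f a) - g a‖ ≤ η := fun a => hγ _ _
  have hk₀S : k₀ ∈ S' := by
    apply hSS'
    by_contra hk
    linarith [hvS k₀ hk]
  obtain ⟨a₀, ha₀⟩ := (hfr k₀).2 hk₀S
  have hga₀ : κ - η ≤ ‖(g a₀ : ℂ)‖ := by
    have h1 := hgv a₀
    rw [ha₀] at h1
    have h2 := norm_sub_norm_le (v k₀) (g a₀)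
    linarith
  refine ⟨f, hf, g, ⟨γ w hw, hγG _ _⟩, a₀, i, ?_, ?_⟩
  · rw [← norm_pos_iff]
    linarith
  · intro j hj hji
    have hjS : j ∉ S' := fun h' => hj ((hfr j).2 h')
    have hvj : ‖v j‖ ≤ ρ := hvS j fun h' => hjS (hSS' h')
    have h1 := hsum j hji hvj
    have hsplit : ∑ k, Y k j * v k = ∑ a, Y (f a) j * v (f a) + ∑ k ∈ S'ᶜ, Y k j * v k := by
      rw [← Finset.sum_add_sum_compl S']
      congr 1
      rw [← himg, Finset.sum_image fun a _ b _ hab => hf hab]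
    have hdecomp : ∑ a, Y (f a) j * (g a : ℂ) - s * γ w hw
        = (∑ k, Y k j * v k - s * w) - ∑ k ∈ S'ᶜ, Y k j * v k
          - ∑ a, Y (f a) j * (v (f a) - g a) + s * (w - γ w hw) := by
      rw [hsplit]
      simp only [mul_sub, Finset.sum_sub_distrib]
      ring
    have h2 : ‖∑ k ∈ S'ᶜ, Y k j * v k‖ ≤ n * K * ρ := by
      calc ‖∑ k ∈ S'ᶜ, Y k j * v k‖ ≤ ∑ k ∈ S'ᶜ, K * ρ := by
            refine norm_sum_le_of_le _ fun k hk => ?_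
            rw [norm_mul]
            have := hvS k fun h' => (Finset.mem_compl.1 hk) (hSS' h')
            gcongr
            exact hY k j
        _ = (S'ᶜ.card : ℝ) * (K * ρ) := by simp
        _ ≤ n * (K * ρ) := by
            gcongr
            simpa using Finset.card_le_univ S'ᶜ
        _ = n * K * ρ := by ring
    have h3 : ‖∑ a, Y (f a) j * (v (f a) - g a)‖ ≤ m * K * η := by
      calc ‖∑ a, Y (f a) j * (v (f a) - g a)‖ ≤ ∑ a : Fin m, K * η := by
            refine norm_sum_le_of_le _ fun a _ => ?_
            rw [norm_mul]
            gcongr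
            · exact hY _ _
            · exact hgv a
        _ = m * K * η := by simp; ring
    have h4 : ‖s * (w - γ w hw)‖ ≤ ‖s‖ * η := by
      rw [norm_mul]
      gcongr
      exact hγ w hw
    change ‖∑ a, Y (f a) j * (g a : ℂ) - s * γ w hw‖ ≤ δ * ‖(g a₀ : ℂ)‖
    rw [hdecomp]
    calc _ ≤ ‖∑ k, Y k j * v k - s * w‖ + ‖∑ k ∈ S'ᶜ, Y k j * v k‖
          + ‖∑ a, Y (f a) j * (v (f a) - g a)‖ + ‖s * (w - γ w hw)‖ :=
          (norm_add_le _ _).trans (add_le_add ((norm_sub_le _ _).trans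
            (add_le_add (norm_sub_le _ _) le_rfl)) le_rfl)
      _ ≤ β + n * K * ρ + m * K * η + ‖s‖ * η := by gcongr
      _ ≤ δ * (κ - η) := hbound
      _ ≤ δ * ‖(g a₀ : ℂ)‖ := by gcongr

/-! ### Rows against unit vectors orthogonal to the other rows -/

/-- The `j`-th coordinate of `(L - s) u`, where `L` is the Laplacian of the matrix `Z`. -/
def laplacianRow {n : ℕ} (Z : Fin n → Fin n → ℂ) (s : ℂ) (u : Fin n → ℂ) (j : Fin n) : ℂ :=
  ∑ k, Z j k * (u k - u j) - s * u j

lemma laplacianMatrix_sub_smul_mulVec {n : ℕ} (Z : Matrix (Fin n) (Fin n) ℂ) (s : ℂ)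
    (u : Fin n → ℂ) (j : Fin n) :
    ((laplacianMatrix Z - s • (1 : Matrix (Fin n) (Fin n) ℂ)).mulVec u) j
      = laplacianRow Z s u j := by
  simp only [laplacianMatrix, Matrix.sub_mulVec, Matrix.smul_mulVec, Matrix.one_mulVec,
    Matrix.mulVec_diagonal, Pi.sub_apply, Pi.smul_apply, smul_eq_mul, laplacianRow, mul_sub,
    Finset.sum_sub_distrib, Finset.sum_mul]
  rfl

lemma vecMul_laplacianMatrix_sub_smul {n : ℕ} (Z : Matrix (Fin n) (Fin n) ℂ) (s : ℂ)
    (y : Fin n → ℂ) (j : Fin n) :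
    (Matrix.vecMul y (laplacianMatrix Z - s • (1 : Matrix (Fin n) (Fin n) ℂ))) j
      = ∑ k, Z k j * y k - y j * (∑ k, Z j k + s) := by
  simp only [laplacianMatrix, Matrix.vecMul_sub, Matrix.vecMul_smul, Matrix.vecMul_one,
    Matrix.vecMul_diagonal, Pi.sub_apply, Pi.smul_apply, smul_eq_mul]
  have : Matrix.vecMul y Z j = ∑ k, Z k j * y k := by
    simp only [Matrix.vecMul, dotProduct, mul_comm]
  rw [this]
  ring

/-- The complex unit sphere of Euclidean norm, with coordinates in the product space. -/
def coordSphere (n : ℕ) : Set (Fin n → ℂ) := {u | ∑ k, ‖u k‖ ^ 2 = 1}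

lemma norm_le_one_of_mem_coordSphere {n : ℕ} {u : Fin n → ℂ} (hu : u ∈ coordSphere n) (k : Fin n) :
    ‖u k‖ ≤ 1 := by
  have h1 : ‖u k‖ ^ 2 ≤ ∑ k, ‖u k‖ ^ 2 :=
    Finset.single_le_sum (f := fun k => ‖u k‖ ^ 2) (fun _ _ => by positivity) (Finset.mem_univ k)
  rw [show ∑ k, ‖u k‖ ^ 2 = 1 from hu] at h1
  exact (sq_le_one_iff₀ (norm_nonneg _)).1 h1

lemma exists_le_norm_of_mem_coordSphere {n : ℕ} {u : Fin n → ℂ} (hu : u ∈ coordSphere n) :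
    ∃ k, 1 / √(n : ℝ) ≤ ‖u k‖ := by
  by_contra! h
  have hu' : ∑ k, ‖u k‖ ^ 2 = 1 := hu
  rcases Nat.eq_zero_or_pos n with rfl | hn
  · simp at hu'
  · have hn' : (0 : ℝ) < n := by exact_mod_cast hn
    have : ∑ k, ‖u k‖ ^ 2 < ∑ _k : Fin n, (1 / √(n : ℝ)) ^ 2 := by
      have : Nonempty (Fin n) := ⟨⟨0, hn⟩⟩
      refine Finset.sum_lt_sum_of_nonempty Finset.univ_nonempty fun k _ => ?_
      have := h k
      gcongr
    rw [hu', Finset.sum_const, Finset.card_univ, Fintype.card_fin, nsmul_eq_mul, div_pow, one_pow,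
      Real.sq_sqrt hn'.le, mul_one_div_cancel hn'.ne'] at this
    exact lt_irrefl _ this

lemma isCompact_coordSphere (n : ℕ) : IsCompact (coordSphere n) := by
  refine Metric.isCompact_of_isClosed_isBounded ?_ ?_
  · exact isClosed_eq (by fun_prop) continuous_const
  · refine (Metric.isBounded_closedBall (x := (0 : Fin n → ℂ)) (r := 1)).subset fun u hu => ?_
    rw [mem_closedBall_zero_iff, pi_norm_le_iff_of_nonneg zero_le_one]
    exact norm_le_one_of_mem_coordSphere hu

lemma exists_smul_mem_coordSphere {n : ℕ} {v : Fin n → ℂ} (hv : v ≠ 0) :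
    ∃ c : ℂ, c ≠ 0 ∧ c • v ∈ coordSphere n := by
  obtain ⟨k, hk⟩ := Function.ne_iff.1 hv
  have hpos : 0 < ∑ k, ‖v k‖ ^ 2 :=
    Finset.sum_pos' (fun _ _ => by positivity) ⟨k, Finset.mem_univ k, by
      have := norm_pos_iff.2 hk; positivity⟩
  refine ⟨((√(∑ k, ‖v k‖ ^ 2))⁻¹ : ℝ), ?_, ?_⟩
  · rw [Complex.ofReal_ne_zero]
    positivity
  · change ∑ k, ‖((√(∑ k, ‖v k‖ ^ 2))⁻¹ : ℝ) • v k‖ ^ 2 = 1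
    simp only [norm_smul, mul_pow, ← Finset.mul_sum]
    rw [Real.norm_of_nonneg (by positivity), inv_pow, Real.sq_sqrt hpos.le,
      inv_mul_cancel₀ hpos.ne']

lemma exists_unit_laplacianRow_eq_zero {n : ℕ} (Z : Fin n → Fin n → ℂ) (s : ℂ) (i : Fin n) :
    ∃ u ∈ coordSphere n, ∀ j, j ≠ i → laplacianRow Z s u j = 0 := by
  set M : Matrix (Fin n) (Fin n) ℂ :=
    Matrix.updateRow (laplacianMatrix Z - s • (1 : Matrix (Fin n) (Fin n) ℂ)) i 0 with hM
  have hdet : M.det = 0 := Matrix.det_eq_zero_of_row_eq_zero i fun j => by simp [hM]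
  obtain ⟨v, hv, hMv⟩ := Matrix.exists_mulVec_eq_zero_iff.2 hdet
  obtain ⟨c, -, hc⟩ := exists_smul_mem_coordSphere hv
  refine ⟨_, hc, fun j hj => ?_⟩
  rw [← laplacianMatrix_sub_smul_mulVec Z s (c • v) j, Matrix.mulVec_smul, Pi.smul_apply]
  have : (M.mulVec v) j = 0 := by rw [hMv]; rfl
  rw [Matrix.mulVec, hM, Matrix.updateRow_ne hj] at this
  rw [Matrix.mulVec, this, smul_zero]

/-- Row `i` of the shifted Laplacian is nearly orthogonal to all unit vectors that are orthogonal to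
the other rows, and every such vector differs from its `i`-th coordinate by more than `ρ` at some
index outside any given `m` indices. -/
def rowDegenerate {n : ℕ} (s : ℂ) (ρ r : ℝ) (m : ℕ) (i : Fin n) : Set (Fin n → Fin n → ℂ) :=
  {Z | ∀ u ∈ coordSphere n, (∀ j, j ≠ i → laplacianRow Z s u j = 0) →
    ‖laplacianRow Z s u i‖ ≤ r ∧ ∀ S : Finset (Fin n), S.card ≤ m → ∃ k, k ∉ S ∧ ρ < ‖u k - u i‖}

lemma isClosed_exists_mem_of_isCompact {α β : Type*} [TopologicalSpace α] [TopologicalSpace β]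
    {K : Set β} (hK : IsCompact K) {C : Set (α × β)} (hC : IsClosed C) :
    IsClosed {a | ∃ b ∈ K, (a, b) ∈ C} := by
  have := isCompact_iff_compactSpace.1 hK
  have h1 : IsClosed {p : α × K | (p.1, (p.2 : β)) ∈ C} :=
    hC.preimage (by fun_prop)
  convert! isClosedMap_fst_of_compactSpace _ h1 using 1
  ext a
  simp

/-- The complement is a countable union of projections of closed sets along a compact sphere. -/
lemma measurableSet_rowDegenerate {n : ℕ} (s : ℂ) (ρ r : ℝ) (m : ℕ) (i : Fin n) :
    MeasurableSet (rowDegenerate s ρ r m i) := by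
  have hcont : ∀ j, Continuous fun p : (Fin n → Fin n → ℂ) × (Fin n → ℂ) =>
      laplacianRow p.1 s p.2 j := by
    intro j
    unfold laplacianRow
    fun_prop
  have horth : IsClosed {p : (Fin n → Fin n → ℂ) × (Fin n → ℂ) |
      ∀ j, j ≠ i → laplacianRow p.1 s p.2 j = 0} := by
    simp only [Set.ofPred_forall]
    exact isClosed_iInter fun j => isClosed_iInter fun _ => isClosed_eq (hcont j) continuous_const
  have hcompl : (rowDegenerate s ρ r m i)ᶜ =
      (⋃ l : ℕ, {Z | ∃ u ∈ coordSphere n, (Z, u) ∈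
        {p : (Fin n → Fin n → ℂ) × (Fin n → ℂ) | ∀ j, j ≠ i → laplacianRow p.1 s p.2 j = 0} ∩
        {p | r + 1 / ((l : ℝ) + 1) ≤ ‖laplacianRow p.1 s p.2 i‖}}) ∪
      ⋃ S : {S : Finset (Fin n) // S.card ≤ m}, {Z | ∃ u ∈ coordSphere n, (Z, u) ∈
        {p : (Fin n → Fin n → ℂ) × (Fin n → ℂ) | ∀ j, j ≠ i → laplacianRow p.1 s p.2 j = 0} ∩
        ⋂ k, ⋂ _ : k ∉ S.1, {p | ‖p.2 k - p.2 i‖ ≤ ρ}} := by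
    ext Z
    simp only [rowDegenerate, Set.mem_compl_iff, Set.mem_ofPred_eq, Set.mem_union, Set.mem_iUnion,
      Set.mem_inter_iff, Set.mem_iInter]
    constructor
    · intro h
      push Not at h
      obtain ⟨u, hu, horth, h⟩ := h
      by_cases hr : ‖laplacianRow Z s u i‖ ≤ r
      · obtain ⟨S, hS, hk⟩ := h hr
        exact Or.inr ⟨⟨S, hS⟩, u, hu, horth, hk⟩
      · obtain ⟨l, hl⟩ := exists_nat_one_div_lt (sub_pos.2 (not_le.1 hr))
        exact Or.inl ⟨l, u, hu, horth, by linarith⟩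
    · rintro (⟨l, u, hu, horth, hl⟩ | ⟨S, u, hu, horth, hk⟩) h
      · have h1 := (h u hu horth).1
        have h2 : (0 : ℝ) < 1 / ((l : ℝ) + 1) := by positivity
        linarith
      · obtain ⟨k, hkS, hlt⟩ := (h u hu horth).2 S.1 S.2
        exact absurd (hk k hkS) (not_le.2 hlt)
  rw [← MeasurableSet.compl_iff, hcompl]
  refine MeasurableSet.union (MeasurableSet.iUnion fun l => ?_) (MeasurableSet.iUnion fun S => ?_)
  · refine (isClosed_exists_mem_of_isCompact (isCompact_coordSphere n) (horth.inter ?_)).measurableSet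
    exact isClosed_le continuous_const (hcont i).norm
  · refine (isClosed_exists_mem_of_isCompact (isCompact_coordSphere n) (horth.inter ?_)).measurableSet
    exact isClosed_iInter fun k => isClosed_iInter fun _ =>
      isClosed_le (by fun_prop) continuous_const

/-- Vectors orthogonal to the other rows do not involve row `i`, so once these are fixed, a single
such vector may be used, and anticoncentration applies to the resampled row `i`. -/
theorem IsEllipticMatrix.measure_rowDegenerate_le {Ω₀ : Type*} [MeasurableSpace Ω₀]
    {P₀ : Measure Ω₀} [IsProbabilityMeasure P₀] {ξ₁ ξ₂ : Ω₀ → ℂ} (hξ₁ : Measurable ξ₁)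
    (hξ₂ : Measurable ξ₂) {ε δ : ℝ} (hε : 0 ≤ ε) (hε1 : ε ≤ 1) (hδ : 0 ≤ δ)
    (hs : IsCondSpreadLaw P₀ ξ₁ ξ₂ ε δ)
    {Ω : Type*} [MeasurableSpace Ω] {P : Measure Ω} [IsProbabilityMeasure P]
    {n : ℕ} {X : Ω → Matrix (Fin n) (Fin n) ℂ} (h : IsEllipticMatrix P₀ ξ₁ ξ₂ P X) (i : Fin n)
    (s : ℂ) {ρ r : ℝ} (hρ : 0 ≤ ρ) (hr : 0 ≤ r) (hrρ : 4 * r ≤ ρ * δ) (m q : ℕ) :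
    P {ω | (fun a b => X ω a b) ∈ rowDegenerate s ρ r m i}
      ≤ ENNReal.ofReal (2 / √(q + 1) + 2 * 2 ^ q * (1 - ε / 2) ^ m) := by
  classical
  refine h.measure_le_of_forall_update hξ₁ hξ₂ hs i (measurableSet_rowDegenerate s ρ r m i) _ ?_
  intro A μ hμ hspread
  obtain ⟨u, hu, horth⟩ := exists_unit_laplacianRow_eq_zero A s i
  have horth' : ∀ x j, j ≠ i → laplacianRow (Function.update A i x) s u j = 0 := by
    intro x j hj
    rw [← horth j hj]
    simp only [laplacianRow, Function.update_of_ne hj]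
  rcases Set.eq_empty_or_nonempty {x | Function.update A i x ∈ rowDegenerate s ρ r m i} with
    hempty | ⟨x₀, hx₀⟩
  · rw [hempty, measure_empty]
    exact zero_le
  set T : Finset (Fin n) := Finset.univ.filter fun k => ρ < ‖u k - u i‖ with hT
  have hTm : m ≤ T.card := by
    by_contra hcon
    obtain ⟨k, hk, hlt⟩ := (hx₀ u hu (horth' x₀)).2 T (not_le.1 hcon).le
    exact hk (Finset.mem_filter.2 ⟨Finset.mem_univ k, hlt⟩)
  have hTk : ∀ k ∈ T, ρ < ‖u k - u i‖ := fun k hk => (Finset.mem_filter.1 hk).2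
  have hsub : {x | Function.update A i x ∈ rowDegenerate s ρ r m i}
      ⊆ {x | ‖∑ k, (u k - u i) * x k - s * u i‖ ≤ r} := by
    intro x hx
    have h1 := (hx u hu (horth' x)).1
    simp only [laplacianRow, Function.update_self] at h1
    change ‖∑ k, (u k - u i) * x k - s * u i‖ ≤ r
    simpa only [mul_comm] using h1
  refine (measure_mono hsub).trans ?_
  rw [← ofReal_measureReal]
  refine ENNReal.ofReal_le_ofReal ((measureReal_sum_near_le (ε := ε) (δ := δ) μ hr T ?_ _ ?_ ?_ _ q).trans ?_)
  · intro k hk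
    refine hspread k ?_
    rintro rfl
    have := hTk k hk
    simp only [sub_self, norm_zero] at this
    linarith
  · exact fun k hk => norm_pos_iff.1 (hρ.trans_lt (hTk k hk))
  · intro k hk
    have := (hTk k hk).le
    exact hrρ.trans (by gcongr)
  · gcongr 2 / √(q + 1) + 2 * 2 ^ q * ?_
    exact pow_le_pow_of_le_one (by linarith) (by linarith) hTm

/-! ### Deterministic reduction -/

/-- If `σ` is the least singular value and `MᴴM x = σ² x`, then `M x` is a left singular vector for
the same singular value, unless it vanishes; in that case `M` is singular, and so is `Mᵀ`. -/
lemma exists_unit_vecMul_norm_le_leastSingularValue {n : ℕ} (hn : 0 < n)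
    (M : Matrix (Fin n) (Fin n) ℂ) :
    ∃ y ∈ coordSphere n, ∀ j, ‖(Matrix.vecMul y M) j‖ ≤ leastSingularValue M := by
  have hσ0 : 0 ≤ leastSingularValue M := LinearMap.singularValues_nonneg _ _
  by_cases hdet : M.det = 0
  · obtain ⟨v, hv, hMv⟩ := Matrix.exists_vecMul_eq_zero_iff.2 hdet
    obtain ⟨c, -, hc⟩ := exists_smul_mem_coordSphere hv
    refine ⟨_, hc, fun j => ?_⟩
    rw [Matrix.smul_vecMul, hMv, smul_zero]
    simpa using hσ0
  · set σ := leastSingularValue M with hσ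
    have hlt : n - 1 < Module.finrank ℂ (EuclideanSpace ℂ (Fin n)) := by simp; omega
    obtain ⟨x, hx⟩ := (LinearMap.hasEigenvalue_adjoint_comp_self_sq_singularValues
      (Matrix.toEuclideanLin M) hlt).exists_hasEigenvector
    have hx0 : x.ofLp ≠ 0 := fun h => hx.2 (by ext k; exact congrFun h k)
    have hxe : M.conjTranspose.mulVec (M.mulVec x.ofLp) = ((σ : ℂ) ^ 2) • x.ofLp := by
      have h1 := hx.apply_eq_smul
      rw [← Matrix.toEuclideanLin_conjTranspose_eq_adjoint] at h1
      exact congrArg WithLp.ofLp h1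
    set y := M.mulVec x.ofLp with hy
    have hy0 : y ≠ 0 := fun h => hdet (Matrix.exists_mulVec_eq_zero_iff.1 ⟨x.ofLp, hx0, h⟩)
    have hdot : ∀ v : Fin n → ℂ, ((∑ k, ‖v k‖ ^ 2 : ℝ) : ℂ) = dotProduct (star v) v := by
      intro v
      simp only [dotProduct, Pi.star_apply, Complex.ofReal_sum]
      refine Finset.sum_congr rfl fun k _ => ?_
      rw [← Complex.normSq_eq_norm_sq, Complex.normSq_eq_conj_mul_self]
      rfl
    have hN : ∑ k, ‖y k‖ ^ 2 = σ ^ 2 * ∑ k, ‖x.ofLp k‖ ^ 2 := by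
      have : ((∑ k, ‖y k‖ ^ 2 : ℝ) : ℂ) = ((σ ^ 2 * ∑ k, ‖x.ofLp k‖ ^ 2 : ℝ) : ℂ) := by
        rw [hdot, Complex.ofReal_mul, hdot]
        have h1 : star y = Matrix.vecMul (star x.ofLp) M.conjTranspose := by
          rw [hy, Matrix.star_mulVec]
        rw [h1, ← Matrix.dotProduct_mulVec, hxe, dotProduct_smul, smul_eq_mul, Complex.ofReal_pow]
      exact_mod_cast this
    have hstar : star y ≠ 0 := star_ne_zero.2 hy0
    obtain ⟨c, -, hc⟩ := exists_smul_mem_coordSphere hstar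
    refine ⟨_, hc, fun j => ?_⟩
    have h2 : Matrix.vecMul (star y) M = star (((σ : ℂ) ^ 2) • x.ofLp) := by
      rw [← hxe, Matrix.star_mulVec M.conjTranspose y, Matrix.conjTranspose_conjTranspose]
    have hc' : ‖c‖ ^ 2 * ∑ k, ‖y k‖ ^ 2 = 1 := by
      rw [Finset.mul_sum, ← show ∑ k, ‖(c • star y) k‖ ^ 2 = 1 from hc]
      refine Finset.sum_congr rfl fun k _ => ?_
      rw [Pi.smul_apply, norm_smul, Pi.star_apply, norm_star, mul_pow]
    have h3 : ‖(Matrix.vecMul (c • star y) M) j‖ ^ 2 ≤ σ ^ 2 := by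
      rw [Matrix.smul_vecMul, h2]
      simp only [Pi.smul_apply, Pi.star_apply, norm_smul, norm_star, norm_pow, mul_pow]
      rw [Complex.norm_real, Real.norm_eq_abs, sq_abs]
      have h4 : ‖x.ofLp j‖ ^ 2 ≤ ∑ k, ‖x.ofLp k‖ ^ 2 :=
        Finset.single_le_sum (f := fun k => ‖x.ofLp k‖ ^ 2) (fun _ _ => by positivity)
          (Finset.mem_univ j)
      calc ‖c‖ ^ 2 * ((σ ^ 2) ^ 2 * ‖x.ofLp j‖ ^ 2)
          ≤ ‖c‖ ^ 2 * ((σ ^ 2) ^ 2 * ∑ k, ‖x.ofLp k‖ ^ 2) := by gcongr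
        _ = σ ^ 2 * (‖c‖ ^ 2 * ∑ k, ‖y k‖ ^ 2) := by rw [hN]; ring
        _ = σ ^ 2 := by rw [hc', mul_one]
    exact le_of_sq_le_sq h3 hσ0

/-- Compatibility of the scales: `K` bounds the entries, `ρ` is the level below which coordinates
are negligible, `η` the mesh of the net, `κ` the size below which a deviation from a constant
vector is excluded by the shift `s`, and `τ` the bound on the least singular value. -/
structure ScalesCompatible (n m : ℕ) (s : ℂ) (δ K ρ η κ τ : ℝ) : Prop where
  two_le : 2 ≤ n
  m_le : m ≤ n
  δ_nonneg : 0 ≤ δ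
  K_nonneg : 0 ≤ K
  ρ_pos : 0 < ρ
  τ_nonneg : 0 ≤ τ
  η_lt : η < κ
  ρ_lt : ρ < κ
  κ_le : κ ≤ 1 / √(n : ℝ)
  net : τ + (n * K + ‖s‖) * ρ + n * K * ρ + m * K * η + ‖s‖ * η ≤ δ * (κ - η)
  shift : n * (K * (2 * κ)) < ‖s‖ * (1 / √(n : ℝ) - 2 * κ)

/-- A unit vector orthogonal to all rows but one is not within `ρ` of a constant off `m`
coordinates. It is not within `κ` of a constant everywhere, since constants are eigenvectors of the
shifted Laplacian with eigenvalue `-s`. -/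
lemma exists_far_of_laplacianRow_eq_zero {n m : ℕ} {s : ℂ} {δ K ρ η κ τ : ℝ}
    (hc : ScalesCompatible n m s δ K ρ η κ τ) {G : Finset ℂ}
    (hG : ∀ x : ℂ, ‖x‖ ≤ 2 → ∃ g ∈ G, ‖x - g‖ ≤ η) {Z : Fin n → Fin n → ℂ}
    (hZ : ∀ a b, ‖Z a b‖ ≤ K) (hnet : (fun a b => Z b a) ∉ sparseNetEvent m G s δ) (i : Fin n)
    {u : Fin n → ℂ} (hu : u ∈ coordSphere n) (horth : ∀ j, j ≠ i → laplacianRow Z s u j = 0)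
    (S : Finset (Fin n)) (hS : S.card ≤ m) : ∃ k, k ∉ S ∧ ρ < ‖u k - u i‖ := by
  by_contra! hcon
  have hu1 := norm_le_one_of_mem_coordSphere hu
  have hsumZ : ∀ (j : Fin n) (v : Fin n → ℂ) (t : ℝ), (∀ k, ‖v k‖ ≤ t) →
      ‖∑ k, Z j k * v k‖ ≤ n * (K * t) := by
    intro j v t hv
    calc ‖∑ k, Z j k * v k‖ ≤ ∑ _k : Fin n, K * t := by
          refine norm_sum_le_of_le _ fun k _ => ?_
          rw [norm_mul]
          exact mul_le_mul (hZ j k) (hv k) (norm_nonneg _) hc.K_nonneg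
      _ = n * (K * t) := by simp
  have hk₀ : ∃ k₀, κ ≤ ‖u k₀ - u i‖ := by
    by_contra! hall
    obtain ⟨k, hk⟩ := exists_le_norm_of_mem_coordSphere hu
    have : Nontrivial (Fin n) := Fin.nontrivial_iff_two_le.2 hc.two_le
    obtain ⟨j, hj⟩ := exists_ne i
    have hdiff : ∀ l, ‖u l - u j‖ ≤ 2 * κ := by
      intro l
      have h1 : u l - u j = (u l - u i) - (u j - u i) := by ring
      rw [h1]
      refine (norm_sub_le _ _).trans ?_
      linarith [hall l, hall j]
    have h2 := horth j hj
    rw [laplacianRow, sub_eq_zero] at h2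
    have h3 : ‖s‖ * ‖u j‖ ≤ n * (K * (2 * κ)) := by
      rw [← norm_mul, ← h2]
      exact hsumZ j _ _ hdiff
    have h4 : 1 / √(n : ℝ) - 2 * κ ≤ ‖u j‖ := by
      have h5 := norm_sub_norm_le (u k) (u j)
      linarith [hdiff k]
    have h6 := mul_le_mul_of_nonneg_left h4 (norm_nonneg s)
    linarith [hc.shift]
  obtain ⟨k₀, hk₀⟩ := hk₀
  refine hnet (mem_sparseNetEvent_of_sparse hc.m_le hc.δ_nonneg hc.K_nonneg hc.ρ_pos.le hc.η_lt
    hc.ρ_lt hG (fun a b => hZ b a) (fun k => u k - u i) (u i) i ?_ ?_ S hS hcon k₀ hk₀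
    (β := (n * K + ‖s‖) * ρ) ?_ ?_)
  · intro k
    refine (norm_sub_le _ _).trans ?_
    linarith [hu1 k, hu1 i]
  · linarith [hu1 i]
  · intro j hj hvj
    have h1 : ∑ k, Z j k * (u k - u i) - s * u i
        = laplacianRow Z s u j + (∑ k, Z j k * (u j - u i) + s * (u j - u i)) := by
      rw [laplacianRow]
      simp only [mul_sub, Finset.sum_sub_distrib]
      ring
    rw [h1, horth j hj, zero_add]
    refine (norm_add_le _ _).trans ?_
    have h2 := hsumZ j (fun _ => u j - u i) ρ fun _ => hvj
    have h3 : ‖s * (u j - u i)‖ ≤ ‖s‖ * ρ := by rw [norm_mul]; gcongr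
    calc _ ≤ n * (K * ρ) + ‖s‖ * ρ := add_le_add h2 h3
      _ = (n * K + ‖s‖) * ρ := by ring
  · linarith [hc.net, hc.τ_nonneg]

/-- An approximate left null vector is not small off `m` coordinates. -/
lemma exists_large_of_vecMul_le {n m : ℕ} {s : ℂ} {δ K ρ η κ τ : ℝ}
    (hc : ScalesCompatible n m s δ K ρ η κ τ) {G : Finset ℂ}
    (hG : ∀ x : ℂ, ‖x‖ ≤ 2 → ∃ g ∈ G, ‖x - g‖ ≤ η) {Z : Matrix (Fin n) (Fin n) ℂ}
    (hZ : ∀ a b, ‖Z a b‖ ≤ K) (hnet : (fun a b => Z a b) ∉ sparseNetEvent m G s δ)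
    {y : Fin n → ℂ} (hy : y ∈ coordSphere n)
    (hyM : ∀ j, ‖(Matrix.vecMul y
      (laplacianMatrix Z - s • (1 : Matrix (Fin n) (Fin n) ℂ))) j‖ ≤ τ)
    (S : Finset (Fin n)) (hS : S.card ≤ m) : ∃ k, k ∉ S ∧ ρ < ‖y k‖ := by
  by_contra! hcon
  have hy1 := norm_le_one_of_mem_coordSphere hy
  obtain ⟨k₀, hk₀⟩ := exists_le_norm_of_mem_coordSphere hy
  refine hnet (mem_sparseNetEvent_of_sparse hc.m_le hc.δ_nonneg hc.K_nonneg hc.ρ_pos.le hc.η_lt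
    hc.ρ_lt hG hZ y 0 k₀ (fun k => (hy1 k).trans one_le_two) (by simp) S hS hcon k₀
    (hc.κ_le.trans hk₀) (β := τ + (n * K + ‖s‖) * ρ) ?_ hc.net)
  intro j _ hj
  have h1 := hyM j
  rw [vecMul_laplacianMatrix_sub_smul] at h1
  have h2 : ‖∑ k, Z j k + s‖ ≤ n * K + ‖s‖ := by
    refine (norm_add_le _ _).trans (add_le_add_left ?_ _)
    calc ‖∑ k, Z j k‖ ≤ ∑ _k : Fin n, K := norm_sum_le_of_le _ fun k _ => hZ j k
      _ = n * K := by simp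
  have h3 : ‖y j * (∑ k, Z j k + s)‖ ≤ (n * K + ‖s‖) * ρ := by
    rw [norm_mul, mul_comm]
    exact mul_le_mul h2 hj (norm_nonneg _) ((norm_nonneg _).trans h2)
  have h4 : ∑ k, Z k j * y k - s * 0
      = (∑ k, Z k j * y k - y j * (∑ k, Z j k + s)) + y j * (∑ k, Z j k + s) := by ring
  rw [h4]
  exact (norm_add_le _ _).trans (add_le_add h1 h3)

/-- Off the net events a small least singular value makes at least `m` rows degenerate: if `y` is
the left singular vector and `u` is orthogonal to the rows `j ≠ i`, then pairing `yᵀ M` with `u`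
leaves the single term `y i * (M u) i`. -/
theorem exists_rowDegenerate_of_leastSingularValue_le {n m : ℕ} {s : ℂ} {δ K ρ η κ τ : ℝ}
    (hc : ScalesCompatible n m s δ K ρ η κ τ) {G : Finset ℂ}
    (hG : ∀ x : ℂ, ‖x‖ ≤ 2 → ∃ g ∈ G, ‖x - g‖ ≤ η) {Z : Matrix (Fin n) (Fin n) ℂ}
    (hZ : ∀ a b, ‖Z a b‖ ≤ K) (hnet : (fun a b => Z a b) ∉ sparseNetEvent m G s δ)
    (hnet' : (fun a b => Z b a) ∉ sparseNetEvent m G s δ)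
    (hτ : leastSingularValue (laplacianMatrix Z - s • (1 : Matrix (Fin n) (Fin n) ℂ)) ≤ τ) :
    ∃ T : Finset (Fin n), m ≤ T.card ∧
      ∀ i ∈ T, (fun a b => Z a b) ∈ rowDegenerate s ρ (n * τ / ρ) m i := by
  obtain ⟨y, hy, hyM⟩ := exists_unit_vecMul_norm_le_leastSingularValue
    (by have := hc.two_le; omega) (laplacianMatrix Z - s • (1 : Matrix (Fin n) (Fin n) ℂ))
  replace hyM := fun j => (hyM j).trans hτ
  set M := laplacianMatrix Z - s • (1 : Matrix (Fin n) (Fin n) ℂ) with hM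
  refine ⟨Finset.univ.filter fun i => ρ < ‖y i‖, ?_, ?_⟩
  · by_contra hlt
    obtain ⟨k, hk, hky⟩ := exists_large_of_vecMul_le hc hG hZ hnet hy hyM _ (not_le.1 hlt).le
    exact hk (Finset.mem_filter.2 ⟨Finset.mem_univ k, hky⟩)
  · intro i hi u hu horth
    refine ⟨?_, exists_far_of_laplacianRow_eq_zero hc hG hZ hnet' i hu horth⟩
    have hyi : ρ < ‖y i‖ := (Finset.mem_filter.1 hi).2
    have h1 : dotProduct (Matrix.vecMul y M) u = y i * laplacianRow Z s u i := by
      rw [← Matrix.dotProduct_mulVec, dotProduct, Finset.sum_eq_single i]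
      · rw [hM, laplacianMatrix_sub_smul_mulVec]
      · intro j _ hj
        rw [hM, laplacianMatrix_sub_smul_mulVec, horth j hj, mul_zero]
      · simp
    have h2 : ‖dotProduct (Matrix.vecMul y M) u‖ ≤ n * τ := by
      calc ‖dotProduct (Matrix.vecMul y M) u‖ ≤ ∑ _k : Fin n, τ := by
            refine norm_sum_le_of_le _ fun k _ => ?_
            rw [norm_mul]
            calc _ ≤ τ * 1 := mul_le_mul (hyM k) (norm_le_one_of_mem_coordSphere hu k)
                  (norm_nonneg _) hc.τ_nonneg
              _ = τ := mul_one _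
        _ = n * τ := by simp
    rw [h1, norm_mul] at h2
    rw [le_div_iff₀ hc.ρ_pos]
    refine le_trans ?_ h2
    rw [mul_comm]
    gcongr

/-! ### Scales and asymptotics -/

lemma eventually_ceil_rpow_bounds : ∀ᶠ n : ℕ in atTop,
    (n : ℝ) ^ (3 / 4 : ℝ) ≤ (⌈(n : ℝ) ^ (3 / 4 : ℝ)⌉₊ : ℝ) ∧
    (⌈(n : ℝ) ^ (3 / 4 : ℝ)⌉₊ : ℝ) ≤ 2 * (n : ℝ) ^ (3 / 4 : ℝ) := by
  filter_upwards [eventually_ge_atTop 1] with n hn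
  have h1 : (1 : ℝ) ≤ (n : ℝ) ^ (3 / 4 : ℝ) :=
    Real.one_le_rpow (by exact_mod_cast hn) (by norm_num)
  refine ⟨Nat.le_ceil _, ?_⟩
  have := Nat.ceil_lt_add_one (zero_le_one.trans h1)
  linarith

/-- The union bound over the net is beaten by the small-ball probability. -/
lemma eventually_net_union_bound {ε : ℝ} (hε : 0 < ε) (hε1 : ε ≤ 1) : ∀ᶠ n : ℕ in atTop,
    ∀ g : ℕ, g ≤ 49 * (n ^ 10) ^ 2 →
    (((n ^ ⌈(n : ℝ) ^ (3 / 4 : ℝ)⌉₊ * (g ^ ⌈(n : ℝ) ^ (3 / 4 : ℝ)⌉₊ *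
      (g * (⌈(n : ℝ) ^ (3 / 4 : ℝ)⌉₊ * n))) : ℕ) : ℝ))
      * (1 - ε) ^ (n - ⌈(n : ℝ) ^ (3 / 4 : ℝ)⌉₊ - 1) ≤ 4 / (ε * n) := by
  have hlog : ∀ᶠ n : ℕ in atTop, 90 * Real.log n ≤ ε / 4 * (n : ℝ) ^ (1 / 4 : ℝ) := by
    have h1 := (isLittleO_log_rpow_atTop (show (0 : ℝ) < 1 / 4 by norm_num)).bound
      (show 0 < ε / 360 by positivity)
    filter_upwards [tendsto_natCast_atTop_atTop.eventually h1, eventually_ge_atTop 1] with n hn hn1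
    have hn1' : (1 : ℝ) ≤ n := by exact_mod_cast hn1
    rw [Real.norm_of_nonneg (Real.log_nonneg hn1'), Real.norm_of_nonneg (by positivity)] at hn
    linarith
  have hfour : ∀ᶠ n : ℕ in atTop, (8 : ℝ) ≤ (n : ℝ) ^ (1 / 4 : ℝ) :=
    ((tendsto_rpow_atTop (show (0 : ℝ) < 1 / 4 by norm_num)).comp
      tendsto_natCast_atTop_atTop).eventually_ge_atTop 8
  filter_upwards [hlog, hfour, eventually_ceil_rpow_bounds, eventually_ge_atTop 49]
    with n hlog hfour hm hn49 g hg
  set m := ⌈(n : ℝ) ^ (3 / 4 : ℝ)⌉₊ with hmdef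
  have hn0 : (0 : ℝ) < n := by exact_mod_cast (by omega : 0 < n)
  set t := (n : ℝ) ^ (1 / 4 : ℝ) with ht
  have ht3 : (n : ℝ) ^ (3 / 4 : ℝ) = t ^ 3 := by
    rw [ht, ← Real.rpow_natCast, ← Real.rpow_mul hn0.le]; norm_num
  have ht4 : (n : ℝ) = t ^ 4 := by
    rw [ht, ← Real.rpow_natCast, ← Real.rpow_mul hn0.le]; norm_num
  rw [ht3] at hm
  have ht0 : 0 < t := by linarith
  have hm4 : 4 * (m : ℝ) ≤ n := by
    rw [ht4]
    nlinarith [pow_pos ht0 3]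
  have hm1 : 1 ≤ m := by
    have : (0 : ℝ) < m := lt_of_lt_of_le (by positivity) hm.1
    exact_mod_cast this
  have hm4' : 4 * m ≤ n := by exact_mod_cast hm4
  have hg' : g ≤ n ^ 21 := by
    calc g ≤ 49 * (n ^ 10) ^ 2 := hg
      _ ≤ n * (n ^ 10) ^ 2 := Nat.mul_le_mul_right _ hn49
      _ = n ^ 21 := by ring
  have hcount : n ^ m * (g ^ m * (g * (m * n))) ≤ n ^ (45 * m) := by
    calc n ^ m * (g ^ m * (g * (m * n)))
        ≤ n ^ m * ((n ^ 21) ^ m * (n ^ 21 * (n * n))) := by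
          gcongr
          omega
      _ = n ^ (22 * m + 23) := by ring
      _ ≤ n ^ (45 * m) := Nat.pow_le_pow_right (by omega) (by omega)
  have hexp1 : ((n ^ (45 * m) : ℕ) : ℝ) = Real.exp (45 * m * Real.log n) := by
    rw [Nat.cast_pow, ← Real.rpow_natCast, Real.rpow_def_of_pos hn0]
    congr 1
    push_cast
    ring
  have hexp2 : (1 - ε) ^ (n - m - 1) ≤ Real.exp (-(ε * n / 2)) := by
    calc (1 - ε) ^ (n - m - 1) ≤ Real.exp (-ε) ^ (n - m - 1) := by
          exact pow_le_pow_left₀ (by linarith) (Real.one_sub_le_exp_neg ε) _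
      _ = Real.exp (-(ε * ((n - m - 1 : ℕ) : ℝ))) := by
          rw [← Real.exp_nat_mul]
          congr 1
          ring
      _ ≤ Real.exp (-(ε * n / 2)) := by
          apply Real.exp_le_exp.2
          have h1 : (n : ℝ) / 2 ≤ ((n - m - 1 : ℕ) : ℝ) := by
            have h2 : n ≤ 2 * (n - m - 1) := by omega
            have h3 : (n : ℝ) ≤ 2 * ((n - m - 1 : ℕ) : ℝ) := by exact_mod_cast h2
            linarith
          have := mul_le_mul_of_nonneg_left h1 hε.le
          linarith
  have hexp3 : 45 * m * Real.log n ≤ ε * n / 4 := by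
    have hl0 : 0 ≤ Real.log n := Real.log_nonneg (by exact_mod_cast (by omega : 1 ≤ n))
    calc 45 * m * Real.log n ≤ 45 * (2 * t ^ 3) * Real.log n := by gcongr; exact hm.2
      _ = t ^ 3 * (90 * Real.log n) := by ring
      _ ≤ t ^ 3 * (ε / 4 * t) := by gcongr
      _ = ε * n / 4 := by rw [ht4]; ring
  calc _ ≤ ((n ^ (45 * m) : ℕ) : ℝ) * Real.exp (-(ε * n / 2)) := by
        refine mul_le_mul (by exact_mod_cast hcount) hexp2 ?_ (by positivity)
        exact pow_nonneg (by linarith) _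
    _ = Real.exp (45 * m * Real.log n + -(ε * n / 2)) := by rw [hexp1, Real.exp_add]
    _ ≤ Real.exp (-(ε * n / 4)) := Real.exp_le_exp.2 (by linarith)
    _ ≤ 4 / (ε * n) := by
        have h1 : ε * n / 4 ≤ Real.exp (ε * n / 4) := by
          linarith [Real.add_one_le_exp (ε * n / 4)]
        rw [Real.exp_neg, inv_eq_one_div, div_le_div_iff₀ (Real.exp_pos _) (by positivity)]
        linarith

/-- Anticoncentration at the rate `m ^ (-1/2)` outweighs the loss `n / m` from averaging over the
rows. -/
lemma eventually_row_average_bound {ε : ℝ} (hε : 0 < ε) (hε1 : ε ≤ 1) : ∀ᶠ n : ℕ in atTop,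
    n * (2 / √((⌊ε * ⌈(n : ℝ) ^ (3 / 4 : ℝ)⌉₊ / 4⌋₊ : ℝ) + 1)
      + 2 * 2 ^ ⌊ε * ⌈(n : ℝ) ^ (3 / 4 : ℝ)⌉₊ / 4⌋₊ * (1 - ε / 2) ^ ⌈(n : ℝ) ^ (3 / 4 : ℝ)⌉₊)
      / ⌈(n : ℝ) ^ (3 / 4 : ℝ)⌉₊
      ≤ 4 / √ε * (n : ℝ) ^ (-(1 / 8) : ℝ) + 8 / ε * (n : ℝ) ^ (-(1 / 2) : ℝ) := by
  filter_upwards [eventually_ceil_rpow_bounds, eventually_ge_atTop 1] with n hm hn1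
  set m := ⌈(n : ℝ) ^ (3 / 4 : ℝ)⌉₊ with hmdef
  -- half of the exponential rate `ε m / 2` absorbs the factor `2 ^ q`
  set q := ⌊ε * m / 4⌋₊ with hq
  have hn0 : (0 : ℝ) < n := by exact_mod_cast hn1
  have hn34 : 0 < (n : ℝ) ^ (3 / 4 : ℝ) := by positivity
  have hm0 : (0 : ℝ) < m := hn34.trans_le hm.1
  have hq1 : ε * m / 4 ≤ q + 1 := (Nat.lt_floor_add_one _).le
  have hq2 : (q : ℝ) ≤ ε * m / 4 := Nat.floor_le (by positivity)
  have hA : 2 / √((q : ℝ) + 1) ≤ 4 / √ε * (n : ℝ) ^ (-(3 / 8) : ℝ) := by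
    have h1 : √ε * (n : ℝ) ^ (3 / 8 : ℝ) / 2 ≤ √((q : ℝ) + 1) := by
      apply Real.le_sqrt_of_sq_le
      rw [div_pow, mul_pow, Real.sq_sqrt hε.le, ← Real.rpow_natCast, ← Real.rpow_mul hn0.le]
      norm_num
      refine le_trans ?_ hq1
      have := mul_le_mul_of_nonneg_left hm.1 hε.le
      linarith
    calc 2 / √((q : ℝ) + 1) ≤ 2 / (√ε * (n : ℝ) ^ (3 / 8 : ℝ) / 2) := by gcongr
      _ = 4 / √ε * (n : ℝ) ^ (-(3 / 8) : ℝ) := by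
        rw [Real.rpow_neg hn0.le]
        have : 0 < √ε := Real.sqrt_pos.2 hε
        field_simp
        norm_num
  have hB : 2 * 2 ^ q * (1 - ε / 2) ^ m ≤ 8 / ε * (n : ℝ) ^ (-(3 / 4) : ℝ) := by
    have h1 : (2 : ℝ) ^ q ≤ Real.exp q := by
      rw [← Real.exp_one_pow]
      have := Real.exp_one_gt_d9
      gcongr
      linarith
    have h2 : (1 - ε / 2) ^ m ≤ Real.exp (-(ε * m / 2)) := by
      calc (1 - ε / 2) ^ m ≤ Real.exp (-(ε / 2)) ^ m := by
            exact pow_le_pow_left₀ (by linarith) (Real.one_sub_le_exp_neg _) _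
        _ = Real.exp (-(ε * m / 2)) := by
            rw [← Real.exp_nat_mul]
            congr 1
            ring
    have h3 : Real.exp (-(ε * m / 4)) ≤ 4 / (ε * m) := by
      have h4 : ε * m / 4 ≤ Real.exp (ε * m / 4) := by
        linarith [Real.add_one_le_exp (ε * m / 4)]
      rw [Real.exp_neg, inv_eq_one_div, div_le_div_iff₀ (Real.exp_pos _) (by positivity)]
      linarith
    calc 2 * 2 ^ q * (1 - ε / 2) ^ m ≤ 2 * Real.exp q * Real.exp (-(ε * m / 2)) := by
          refine mul_le_mul (by gcongr) h2 (pow_nonneg (by linarith) _) (by positivity)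
      _ = 2 * Real.exp (q + -(ε * m / 2)) := by rw [Real.exp_add]; ring
      _ ≤ 2 * Real.exp (-(ε * m / 4)) := by
          gcongr
          linarith
      _ ≤ 2 * (4 / (ε * m)) := by gcongr
      _ ≤ 2 * (4 / (ε * (n : ℝ) ^ (3 / 4 : ℝ))) := by gcongr; exact hm.1
      _ = 8 / ε * (n : ℝ) ^ (-(3 / 4) : ℝ) := by
          rw [Real.rpow_neg hn0.le]
          field_simp
          norm_num
  have hC : (n : ℝ) / m ≤ (n : ℝ) ^ (1 / 4 : ℝ) := by
    rw [div_le_iff₀ hm0]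
    calc (n : ℝ) = (n : ℝ) ^ (1 / 4 : ℝ) * (n : ℝ) ^ (3 / 4 : ℝ) := by
          rw [← Real.rpow_add hn0]; norm_num
      _ ≤ _ := by gcongr; exact hm.1
  have hnn : 0 ≤ 2 * (2 : ℝ) ^ q * (1 - ε / 2) ^ m :=
    mul_nonneg (by positivity) (pow_nonneg (by linarith) _)
  calc n * (2 / √((q : ℝ) + 1) + 2 * 2 ^ q * (1 - ε / 2) ^ m) / m
      = (n : ℝ) / m * (2 / √((q : ℝ) + 1) + 2 * 2 ^ q * (1 - ε / 2) ^ m) := by ring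
    _ ≤ (n : ℝ) ^ (1 / 4 : ℝ) * (4 / √ε * (n : ℝ) ^ (-(3 / 8) : ℝ)
          + 8 / ε * (n : ℝ) ^ (-(3 / 4) : ℝ)) := by
        refine mul_le_mul hC (add_le_add hA hB) (add_nonneg (by positivity) hnn) (by positivity)
    _ = 4 / √ε * ((n : ℝ) ^ (1 / 4 : ℝ) * (n : ℝ) ^ (-(3 / 8) : ℝ))
          + 8 / ε * ((n : ℝ) ^ (1 / 4 : ℝ) * (n : ℝ) ^ (-(3 / 4) : ℝ)) := by ring
    _ = _ := by
        rw [← Real.rpow_add hn0, ← Real.rpow_add hn0]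
        norm_num

/-- Numerical margins behind the choice `K = n²`, `ρ = n⁻¹⁰`, `η = 2 n⁻¹⁰`, `κ = n⁻⁵`,
`τ = n⁻²²`: the errors in the net estimate are of order `n⁻⁷`, below `κ`. -/
lemma eventually_scalesCompatible {z : ℂ} (hz : z ≠ 0) {δ : ℝ} (hδ : 0 < δ) :
    ∀ᶠ n : ℕ in atTop, ∀ m : ℕ, m ≤ n →
      ScalesCompatible n m (z * (√(n : ℝ) : ℂ)) δ ((n : ℝ) ^ 2) ((n : ℝ) ^ 10)⁻¹
        (2 / ((n ^ 10 : ℕ) : ℝ)) ((n : ℝ) ^ 5)⁻¹ ((n : ℝ) ^ 22)⁻¹ := by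
  have hz' : 0 < ‖z‖ := norm_pos_iff.2 hz
  have hlarge : ∀ c : ℝ, ∀ᶠ n : ℕ in atTop, c ≤ (n : ℝ) := fun c =>
    tendsto_natCast_atTop_atTop.eventually_ge_atTop c
  filter_upwards [hlarge 4, hlarge ‖z‖, hlarge (16 / δ), hlarge (5 / ‖z‖)]
    with n h4 hnz hnδ hnz' m hm
  have hm' : (m : ℝ) ≤ n := by exact_mod_cast hm
  rw [div_le_iff₀ hδ] at hnδ
  rw [div_le_iff₀ hz'] at hnz'
  set x : ℝ := (n : ℝ) with hx
  have hx0 : 0 < x := by linarith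
  have hx1 : 1 ≤ x := by linarith
  have hsqrt1 : 1 ≤ √x := Real.one_le_sqrt.2 hx1
  have hsqrt : √x ≤ x := by
    rw [Real.sqrt_le_left hx0.le]
    nlinarith
  have hnorm : ‖z * (√x : ℂ)‖ = ‖z‖ * √x := by
    rw [norm_mul, Complex.norm_real, Real.norm_of_nonneg (Real.sqrt_nonneg _)]
  have hs2 : ‖z‖ * √x ≤ x ^ 2 := by
    rw [sq]
    exact mul_le_mul hnz hsqrt (Real.sqrt_nonneg _) hx0.le
  have hpow : ∀ {a b : ℕ}, a ≤ b → x ^ a ≤ x ^ b := fun h => pow_le_pow_right₀ hx1 h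
  have h5 : 4 * √x ≤ x ^ 5 := by
    calc 4 * √x ≤ x * x := by gcongr
      _ = x ^ 2 := by ring
      _ ≤ x ^ 5 := hpow (by norm_num)
  have hK : ((n ^ 10 : ℕ) : ℝ) = x ^ 10 := by rw [hx]; push_cast; rfl
  have hκ : (x ^ 5)⁻¹ = x ^ 5 * (x ^ 10)⁻¹ := by field_simp
  refine ⟨?_, hm, hδ.le, by positivity, by positivity, by positivity, ?_, ?_, ?_, ?_, ?_⟩
  · have : (2 : ℝ) ≤ (n : ℝ) := by linarith
    exact_mod_cast this
  · rw [hK, hκ, div_eq_mul_inv]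
    gcongr
    calc (2 : ℝ) < 4 := by norm_num
      _ ≤ x ^ 1 := by simpa using h4
      _ ≤ x ^ 5 := hpow (by norm_num)
  · rw [hκ]
    have : (1 : ℝ) < x ^ 5 := one_lt_pow₀ (by linarith) (by norm_num)
    exact lt_mul_of_one_lt_left (by positivity) this
  · rw [one_div]
    gcongr
    linarith
  · rw [hnorm, hK, hκ, div_eq_mul_inv]
    have hρ : 0 < (x ^ 10)⁻¹ := by positivity
    have h22 : (x ^ 22)⁻¹ ≤ x ^ 3 * (x ^ 10)⁻¹ := by
      have : (x ^ 22)⁻¹ ≤ (x ^ 10)⁻¹ := by gcongr; norm_num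
      exact this.trans (le_mul_of_one_le_left hρ.le (one_le_pow₀ hx1))
    have h23 : x ^ 2 ≤ x ^ 3 := hpow (by norm_num)
    have hmK : (m : ℝ) * x ^ 2 ≤ x ^ 3 := by
      calc (m : ℝ) * x ^ 2 ≤ x * x ^ 2 := by gcongr
        _ = x ^ 3 := by ring
    have hbig : 8 * x ^ 3 ≤ δ * (x ^ 5 - 2) := by
      have h51 : (4 : ℝ) ≤ x ^ 5 := by
        calc (4 : ℝ) ≤ x ^ 1 := by simpa using h4
          _ ≤ x ^ 5 := hpow (by norm_num)
      have h52 : 16 * x ^ 3 ≤ δ * x ^ 5 := by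
        have h53 : (16 : ℝ) ≤ x * δ * x := by nlinarith
        have h54 := mul_le_mul_of_nonneg_right h53 (pow_pos hx0 3).le
        calc 16 * x ^ 3 ≤ x * δ * x * x ^ 3 := h54
          _ = δ * x ^ 5 := by ring
      have h55 := mul_le_mul_of_nonneg_left h51 hδ.le
      linarith
    calc (x ^ 22)⁻¹ + (x * x ^ 2 + ‖z‖ * √x) * (x ^ 10)⁻¹ + x * x ^ 2 * (x ^ 10)⁻¹
          + m * x ^ 2 * (2 * (x ^ 10)⁻¹) + ‖z‖ * √x * (2 * (x ^ 10)⁻¹)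
        ≤ x ^ 3 * (x ^ 10)⁻¹ + (x * x ^ 2 + x ^ 3) * (x ^ 10)⁻¹ + x * x ^ 2 * (x ^ 10)⁻¹
          + x ^ 3 * (2 * (x ^ 10)⁻¹) + x ^ 3 * (2 * (x ^ 10)⁻¹) := by
          gcongr
          · exact hs2.trans h23
          · exact hs2.trans h23
      _ = 8 * x ^ 3 * (x ^ 10)⁻¹ := by ring
      _ ≤ δ * (x ^ 5 - 2) * (x ^ 10)⁻¹ := by gcongr
      _ = δ * (x ^ 5 * (x ^ 10)⁻¹ - 2 * (x ^ 10)⁻¹) := by ring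
  · rw [hnorm]
    have h1 : ‖z‖ * √x * (1 / √x - 2 * (x ^ 5)⁻¹) = ‖z‖ * (1 - 2 * √x * (x ^ 5)⁻¹) := by
      have : 0 < √x := by linarith
      field_simp
    have h2 : 2 * √x * (x ^ 5)⁻¹ ≤ 1 / 2 := by
      rw [← div_eq_mul_inv, div_le_iff₀ (by positivity)]
      linarith
    have h3 : x * (x ^ 2 * (2 * (x ^ 5)⁻¹)) = 2 / x ^ 2 := by
      field_simp
    have h4' : 2 / x ^ 2 < ‖z‖ / 2 := by
      rw [div_lt_div_iff₀ (by positivity) (by norm_num)]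
      nlinarith
    rw [h1, h3]
    calc 2 / x ^ 2 < ‖z‖ * (1 / 2) := by linarith
      _ ≤ ‖z‖ * (1 - 2 * √x * (x ^ 5)⁻¹) := by gcongr; linarith

/-! ### Probability bounds in a fixed dimension -/

lemma laplacianMatrix_sub_diagonal {n : ℕ} (X : Matrix (Fin n) (Fin n) ℂ) :
    laplacianMatrix (X - Matrix.diagonal fun i => X i i) = laplacianMatrix X := by
  ext i j
  by_cases h : i = j
  · subst h
    simp [laplacianMatrix, Matrix.diagonal_apply, Finset.sum_sub_distrib]
  · simp [laplacianMatrix, Matrix.diagonal_apply, h]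

lemma IsEllipticMatrix.sub_diagonal {Ω₀ : Type*} [MeasurableSpace Ω₀] {P₀ : Measure Ω₀}
    {ξ₁ ξ₂ : Ω₀ → ℂ} {Ω : Type*} [MeasurableSpace Ω] {P : Measure Ω}
    {n : ℕ} {X : Ω → Matrix (Fin n) (Fin n) ℂ} (h : IsEllipticMatrix P₀ ξ₁ ξ₂ P X) :
    IsEllipticMatrix P₀ ξ₁ ξ₂ P fun ω => X ω - Matrix.diagonal fun i => X ω i i where
  measurable_entry i j := by
    by_cases hij : i = j
    · simp [hij]
    · simpa [Matrix.diagonal_apply, hij] using h.measurable_entry i j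
  indep := by
    refine (h.indep.comp (fun p => if p.1.1 = p.1.2 then fun _ => 0 else id) ?_).congr ?_
    · intro p
      split_ifs
      · exact measurable_const
      · exact measurable_id
    · rintro ⟨⟨i, j⟩, hij⟩
      refine Eventually.of_forall fun ω => ?_
      by_cases h' : i = j
      · subst h'
        simp only [Function.comp, if_true, Matrix.sub_apply, Matrix.diagonal_apply_eq, sub_self]
        rfl
      · simp [h', Ne.symm h']
  identDistrib i j hij := by
    have := h.identDistrib i j hij
    simpa [Matrix.diagonal_apply, hij.ne, hij.ne'] using this

lemma measure_lt_norm_le {Ω₀ : Type*} [MeasurableSpace Ω₀] {P₀ : Measure Ω₀}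
    [IsProbabilityMeasure P₀] {ξ : Ω₀ → ℂ} (hξ : MemLp ξ 2 P₀) {K : ℝ} (hK : 0 < K) :
    P₀ {ω | K < ‖ξ ω‖} ≤ ENNReal.ofReal ((∫ ω, ‖ξ ω‖ ^ 2 ∂P₀) / K ^ 2) := by
  have h1 := mul_meas_ge_le_integral_of_nonneg (μ := P₀) (f := fun ω => ‖ξ ω‖ ^ 2)
    (Eventually.of_forall fun ω => by positivity) hξ.integrable_norm_pow' (K ^ 2)
  have h2 : P₀.real {ω | K ^ 2 ≤ ‖ξ ω‖ ^ 2} ≤ (∫ ω, ‖ξ ω‖ ^ 2 ∂P₀) / K ^ 2 := by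
    rw [le_div_iff₀ (by positivity), mul_comm]
    exact h1
  calc P₀ {ω | K < ‖ξ ω‖} ≤ P₀ {ω | K ^ 2 ≤ ‖ξ ω‖ ^ 2} :=
        measure_mono fun ω (hω : K < ‖ξ ω‖) => by
          change K ^ 2 ≤ ‖ξ ω‖ ^ 2
          gcongr
    _ = ENNReal.ofReal (P₀.real {ω | K ^ 2 ≤ ‖ξ ω‖ ^ 2}) := (ofReal_measureReal).symm
    _ ≤ _ := ENNReal.ofReal_le_ofReal h2

lemma IsEllipticMatrix.measure_exists_entry_lt {Ω₀ : Type*} [MeasurableSpace Ω₀] {P₀ : Measure Ω₀}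
    [IsProbabilityMeasure P₀]
    {ξ₁ ξ₂ : Ω₀ → ℂ} (h₁ : MemLp ξ₁ 2 P₀) (h₂ : MemLp ξ₂ 2 P₀)
    {Ω : Type*} [MeasurableSpace Ω] {P : Measure Ω}
    {n : ℕ} {X : Ω → Matrix (Fin n) (Fin n) ℂ} (h : IsEllipticMatrix P₀ ξ₁ ξ₂ P X)
    (hdiag : ∀ ω i, X ω i i = 0) {K : ℝ} (hK : 0 < K) :
    P {ω | ∃ a b, K < ‖X ω a b‖}
      ≤ ENNReal.ofReal (n ^ 2 * ((∫ ω, ‖ξ₁ ω‖ ^ 2 ∂P₀ + ∫ ω, ‖ξ₂ ω‖ ^ 2 ∂P₀) / K ^ 2)) := by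
  set E₁ := ∫ ω, ‖ξ₁ ω‖ ^ 2 ∂P₀
  set E₂ := ∫ ω, ‖ξ₂ ω‖ ^ 2 ∂P₀
  have hE₁ : 0 ≤ E₁ := integral_nonneg fun _ => by positivity
  have hE₂ : 0 ≤ E₂ := integral_nonneg fun _ => by positivity
  have hset : MeasurableSet {x : ℂ | K < ‖x‖} := measurableSet_lt (by fun_prop) (by fun_prop)
  have hentry : ∀ p : Fin n × Fin n,
      P {ω | K < ‖X ω p.1 p.2‖} ≤ ENNReal.ofReal ((E₁ + E₂) / K ^ 2) := by
    rintro ⟨a, b⟩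
    rcases lt_trichotomy a b with hab | rfl | hab
    · have hid := (h.identDistrib a b hab).comp measurable_fst
      refine (hid.measure_mem_eq hset).trans_le ((measure_lt_norm_le h₁ hK).trans ?_)
      apply ENNReal.ofReal_le_ofReal
      gcongr
      linarith
    · have : {ω | K < ‖X ω a a‖} = ∅ := by
        ext ω
        simp [hdiag, hK.le]
      rw [this, measure_empty]
      exact zero_le
    · have hid := (h.identDistrib b a hab).comp measurable_snd
      refine (hid.measure_mem_eq hset).trans_le ((measure_lt_norm_le h₂ hK).trans ?_)
      apply ENNReal.ofReal_le_ofReal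
      gcongr
      linarith
  have hsub : {ω | ∃ a b, K < ‖X ω a b‖} ⊆ ⋃ p : Fin n × Fin n, {ω | K < ‖X ω p.1 p.2‖} := by
    rintro ω ⟨a, b, hab⟩
    exact Set.mem_iUnion.2 ⟨(a, b), hab⟩
  refine (measure_mono hsub).trans ((measure_iUnion_fintype_le P _).trans ?_)
  refine (Finset.sum_le_card_nsmul _ _ _ fun p _ => hentry p).trans (le_of_eq ?_)
  rw [ENNReal.ofReal_mul (by positivity), nsmul_eq_mul]
  congr 1
  rw [← Nat.cast_pow, ENNReal.ofReal_natCast]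
  simp [sq]

/-- Markov's inequality for the number of events that occur. -/
lemma measure_exists_finset_card_le {Ω ι : Type*} [Fintype ι] [MeasurableSpace Ω] {P : Measure Ω}
    {B : ι → Set Ω} (hB : ∀ i, MeasurableSet (B i)) {m : ℕ} (hm : 0 < m) {p : ℝ}
    (hP : ∀ i, P (B i) ≤ ENNReal.ofReal p) :
    P {ω | ∃ T : Finset ι, m ≤ T.card ∧ ∀ i ∈ T, ω ∈ B i}
      ≤ ENNReal.ofReal (Fintype.card ι * p / m) := by
  classical
  let F : Ω → ENNReal := fun ω => ∑ i, (B i).indicator (fun _ => 1) ω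
  have hF : Measurable F := Finset.measurable_sum _ fun i _ => measurable_const.indicator (hB i)
  have hsub : {ω | ∃ T : Finset ι, m ≤ T.card ∧ ∀ i ∈ T, ω ∈ B i} ⊆ {ω | (m : ENNReal) ≤ F ω} := by
    rintro ω ⟨T, hT, hTB⟩
    change (m : ENNReal) ≤ F ω
    calc (m : ENNReal) ≤ T.card := by exact_mod_cast hT
      _ = ∑ i ∈ T, (B i).indicator (fun _ => 1) ω := by
          rw [Finset.sum_congr rfl fun i hi => Set.indicator_of_mem (hTB i hi) _]
          simp
      _ ≤ F ω := Finset.sum_le_sum_of_subset (Finset.subset_univ T)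
  have hint : ∫⁻ ω, F ω ∂P ≤ ENNReal.ofReal (Fintype.card ι * p) := by
    simp only [F]
    rw [lintegral_finsetSum _ fun i _ => measurable_const.indicator (hB i)]
    simp only [lintegral_indicator (hB _), lintegral_const, one_mul, Measure.restrict_apply_univ]
    refine (Finset.sum_le_card_nsmul _ _ _ fun i _ => hP i).trans (le_of_eq ?_)
    rw [ENNReal.ofReal_mul (by positivity), nsmul_eq_mul, ENNReal.ofReal_natCast, Finset.card_univ]
  have hm' : (0 : ℝ) < m := by exact_mod_cast hm
  refine (measure_mono hsub).trans ((meas_ge_le_lintegral_div hF.aemeasurable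
    (by exact_mod_cast hm.ne') (ENNReal.natCast_ne_top m)).trans ?_)
  rw [ENNReal.ofReal_div_of_pos hm', ENNReal.ofReal_natCast]
  gcongr

/-- The three exceptional events: a large entry, a net event for the matrix or its transpose, or
many degenerate rows. -/
theorem IsEllipticMatrix.measure_leastSingularValue_le {Ω₀ : Type*} [MeasurableSpace Ω₀]
    {P₀ : Measure Ω₀} [IsProbabilityMeasure P₀] {ξ₁ ξ₂ : Ω₀ → ℂ} (hξ₁ : Measurable ξ₁)
    (hξ₂ : Measurable ξ₂) (h₁ : MemLp ξ₁ 2 P₀) (h₂ : MemLp ξ₂ 2 P₀)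
    {ε δ : ℝ} (hε : 0 ≤ ε) (hε1 : ε ≤ 1) (hs : IsCondSpreadLaw P₀ ξ₁ ξ₂ ε δ)
    {Ω : Type*} [MeasurableSpace Ω] {P : Measure Ω} [IsProbabilityMeasure P]
    {n : ℕ} {X : Ω → Matrix (Fin n) (Fin n) ℂ} (h : IsEllipticMatrix P₀ ξ₁ ξ₂ P X)
    (hdiag : ∀ ω i, X ω i i = 0) {m : ℕ} (hm : 0 < m) {s : ℂ} {K ρ η κ τ : ℝ} (hK : 0 < K)
    (hc : ScalesCompatible n m s δ K ρ η κ τ) (hτ : 4 * (n * τ / ρ) ≤ ρ * δ) {G : Finset ℂ}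
    (hG : ∀ x : ℂ, ‖x‖ ≤ 2 → ∃ g ∈ G, ‖x - g‖ ≤ η) (q : ℕ) :
    P {ω | leastSingularValue (laplacianMatrix (X ω) - s • (1 : Matrix (Fin n) (Fin n) ℂ)) ≤ τ}
      ≤ ENNReal.ofReal (n ^ 2 * ((∫ ω, ‖ξ₁ ω‖ ^ 2 ∂P₀ + ∫ ω, ‖ξ₂ ω‖ ^ 2 ∂P₀) / K ^ 2)
        + 2 * (((n ^ m * (G.card ^ m * (G.card * (m * n))) : ℕ) : ℝ) * (1 - ε) ^ (n - m - 1))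
        + n * (2 / √(q + 1) + 2 * 2 ^ q * (1 - ε / 2) ^ m) / m) := by
  set p : ℝ := 2 / √(q + 1) + 2 * 2 ^ q * (1 - ε / 2) ^ m
  have hp0 : 0 ≤ p :=
    add_nonneg (by positivity) (mul_nonneg (by positivity) (pow_nonneg (by linarith) _))
  set N : ℝ := ((n ^ m * (G.card ^ m * (G.card * (m * n))) : ℕ) : ℝ) * (1 - ε) ^ (n - m - 1)
    with hN
  have hN0 : 0 ≤ N := mul_nonneg (Nat.cast_nonneg _) (pow_nonneg (by linarith) _)
  have hNE : ENNReal.ofReal N = ((n ^ m * (G.card ^ m * (G.card * (m * n))) : ℕ) : ENNReal)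
        * ENNReal.ofReal (1 - ε) ^ (n - m - 1) := by
    rw [hN, ENNReal.ofReal_mul (Nat.cast_nonneg _), ENNReal.ofReal_natCast,
      ENNReal.ofReal_pow (by linarith)]
  set E₁ := ∫ ω, ‖ξ₁ ω‖ ^ 2 ∂P₀ with hE₁
  set E₂ := ∫ ω, ‖ξ₂ ω‖ ^ 2 ∂P₀ with hE₂
  have hE₁0 : 0 ≤ E₁ := integral_nonneg fun _ => by positivity
  have hE₂0 : 0 ≤ E₂ := integral_nonneg fun _ => by positivity
  have hXm : Measurable fun ω => (fun a b => X ω a b : Fin n → Fin n → ℂ) :=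
    measurable_pi_iff.2 fun a => measurable_pi_iff.2 fun b => h.measurable_entry a b
  have hr : 0 ≤ n * τ / ρ := div_nonneg (mul_nonneg (Nat.cast_nonneg _) hc.τ_nonneg) hc.ρ_pos.le
  have hsub : {ω | leastSingularValue
        (laplacianMatrix (X ω) - s • (1 : Matrix (Fin n) (Fin n) ℂ)) ≤ τ}
      ⊆ ({ω | ∃ a b, K < ‖X ω a b‖} ∪ ({ω | (fun a b => X ω a b) ∈ sparseNetEvent m G s δ}
        ∪ {ω | (fun a b => (X ω).transpose a b) ∈ sparseNetEvent m G s δ}))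
        ∪ {ω | ∃ T : Finset (Fin n), m ≤ T.card ∧ ∀ i ∈ T, ω ∈
          {ω | (fun a b => X ω a b) ∈ rowDegenerate s ρ (n * τ / ρ) m i}} := by
    intro ω hω
    by_cases hA : ∃ a b, K < ‖X ω a b‖
    · exact Or.inl (Or.inl hA)
    by_cases hL : (fun a b => X ω a b) ∈ sparseNetEvent m G s δ
    · exact Or.inl (Or.inr (Or.inl hL))
    by_cases hR : (fun a b => (X ω).transpose a b) ∈ sparseNetEvent m G s δ
    · exact Or.inl (Or.inr (Or.inr hR))
    push Not at hA
    exact Or.inr (exists_rowDegenerate_of_leastSingularValue_le hc hG hA hL hR hω)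
  have hrow := measure_exists_finset_card_le (P := P)
    (fun i => hXm (measurableSet_rowDegenerate s ρ (n * τ / ρ) m i)) hm
    (fun i => h.measure_rowDegenerate_le hξ₁ hξ₂ hε hε1 hc.δ_nonneg hs i s hc.ρ_pos.le hr hτ m q)
  rw [Fintype.card_fin] at hrow
  refine (measure_mono hsub).trans ?_
  rw [ENNReal.ofReal_add (by positivity) (by positivity),
    ENNReal.ofReal_add (by positivity) (by positivity), two_mul, ENNReal.ofReal_add hN0 hN0]
  refine (measure_union_le _ _).trans (add_le_add ?_ hrow)
  refine (measure_union_le _ _).trans (add_le_add (h.measure_exists_entry_lt h₁ h₂ hdiag hK) ?_)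
  rw [hNE]
  exact (measure_union_le _ _).trans (add_le_add
    (h.measure_sparseNetEvent_le hξ₁ hξ₂ hε hs m G s)
    (h.transpose.measure_sparseNetEvent_le hξ₂ hξ₁ hε hs.symm m G s))

theorem mainTheorem5
    {Ω₀ : Type*} [MeasurableSpace Ω₀] (P₀ : Measure Ω₀) [IsProbabilityMeasure P₀]
    (ξ₁ ξ₂ : Ω₀ → ℂ) (hξ₁ : Measurable ξ₁) (hξ₂ : Measurable ξ₂)
    (hvar₁ : HasUnitVariance P₀ ξ₁) (hvar₂ : HasUnitVariance P₀ ξ₂)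
    (hspread : IsConditionallySpread P₀ ξ₁ ξ₂)
    (z : ℂ) (hz : z ≠ 0) :
    ∃ c : ℝ, 0 < c ∧
      ∀ (Ω : ℕ → Type*) [∀ n, MeasurableSpace (Ω n)]
        (P : ∀ n, Measure (Ω n)) [∀ n, IsProbabilityMeasure (P n)]
        (X : ∀ n, Ω n → Matrix (Fin n) (Fin n) ℂ),
        (∀ n, IsEllipticMatrix P₀ ξ₁ ξ₂ (P n) (X n)) →
        Tendsto
          (fun n : ℕ => P n {ω | leastSingularValue
            (laplacianMatrix (X n ω) - (z * (Real.sqrt n : ℂ)) • (1 : Matrix (Fin n) (Fin n) ℂ))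
              ≤ (n : ℝ) ^ (-c)})
          atTop (𝓝 0) := by
  obtain ⟨ε, δ, hε, hε2, hδ, hs⟩ := hspread.exists_isCondSpreadLaw hξ₁ hξ₂
  have hε1 : ε ≤ 1 := by linarith
  refine ⟨22, by norm_num, ?_⟩
  intro Ω _ P _ X hX
  set E : ℝ := ∫ ω, ‖ξ₁ ω‖ ^ 2 ∂P₀ + ∫ ω, ‖ξ₂ ω‖ ^ 2 ∂P₀ with hE
  let b : ℕ → ℝ := fun n => E * (n : ℝ) ^ (-2 : ℝ) + 8 / ε * (n : ℝ) ^ (-1 : ℝ)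
    + (4 / √ε * (n : ℝ) ^ (-(1 / 8) : ℝ) + 8 / ε * (n : ℝ) ^ (-(1 / 2) : ℝ))
  have hb : Tendsto (fun n => ENNReal.ofReal (b n)) atTop (𝓝 0) := by
    have hlim : ∀ (C a : ℝ), 0 < a → Tendsto (fun n : ℕ => C * (n : ℝ) ^ (-a)) atTop (𝓝 0) := by
      intro C a ha
      simpa using ((tendsto_rpow_neg_atTop ha).comp tendsto_natCast_atTop_atTop).const_mul C
    have h0 : Tendsto b atTop (𝓝 0) := by
      have h1 := ((hlim E 2 (by norm_num)).add (hlim (8 / ε) 1 (by norm_num))).add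
        ((hlim (4 / √ε) (1 / 8) (by norm_num)).add (hlim (8 / ε) (1 / 2) (by norm_num)))
      rwa [add_zero, add_zero] at h1
    simpa using ENNReal.tendsto_ofReal h0
  refine tendsto_of_tendsto_of_tendsto_of_le_of_le' tendsto_const_nhds hb
    (Eventually.of_forall fun n => zero_le) ?_
  filter_upwards [eventually_scalesCompatible hz hδ, eventually_net_union_bound hε hε1,
    eventually_row_average_bound hε hε1, eventually_ge_atTop 1,
    tendsto_natCast_atTop_atTop.eventually_ge_atTop (4 / δ)]
    with n hscale hnet hrow hn1 hnδ
  set m := ⌈(n : ℝ) ^ (3 / 4 : ℝ)⌉₊ with hm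
  have hn1' : (1 : ℝ) ≤ n := by exact_mod_cast hn1
  have hn0 : (0 : ℝ) < n := by linarith
  have hm0 : 0 < m := Nat.ceil_pos.2 (by positivity)
  have hmn : m ≤ n := Nat.ceil_le.2 <| by
    calc (n : ℝ) ^ (3 / 4 : ℝ) ≤ (n : ℝ) ^ (1 : ℝ) :=
          Real.rpow_le_rpow_of_exponent_le hn1' (by norm_num)
      _ = n := Real.rpow_one _
  obtain ⟨G, hGcard, hG⟩ := exists_finset_net_closedBall (n ^ 10) (by positivity)
  have hτ : 4 * (n * ((n : ℝ) ^ 22)⁻¹ / ((n : ℝ) ^ 10)⁻¹) ≤ ((n : ℝ) ^ 10)⁻¹ * δ := by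
    have h1 : (n : ℝ) * ((n : ℝ) ^ 22)⁻¹ / ((n : ℝ) ^ 10)⁻¹ = ((n : ℝ) ^ 10)⁻¹ * (1 / n) := by
      field_simp
    rw [div_le_iff₀ hδ] at hnδ
    rw [h1, mul_left_comm]
    gcongr
    rw [mul_one_div, div_le_iff₀ hn0]
    linarith
  -- the diagonal of `X` cancels in the Laplacian, and may be taken to be zero
  have hmain := (hX n).sub_diagonal.measure_leastSingularValue_le hξ₁ hξ₂ hvar₁.1 hvar₂.1 hε.le hε1
    hs (fun ω i => by simp) hm0 (by positivity) (hscale m hmn) hτ hG ⌊ε * m / 4⌋₊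
  simp only [laplacianMatrix_sub_diagonal] at hmain
  have hpow : (n : ℝ) ^ (-22 : ℝ) = ((n : ℝ) ^ 22)⁻¹ := by
    rw [Real.rpow_neg hn0.le]
    norm_cast
  rw [hpow]
  refine hmain.trans (ENNReal.ofReal_le_ofReal (add_le_add (add_le_add ?_ ?_) hrow))
  · have h2 : (n : ℝ) ^ (-2 : ℝ) = ((n : ℝ) ^ 2)⁻¹ := by
      rw [Real.rpow_neg hn0.le]
      norm_cast
    rw [h2, ← hE]
    refine le_of_eq ?_
    field_simp
  · calc _ ≤ 2 * (4 / (ε * n)) := by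
          gcongr
          exact hnet _ hGcard
      _ = 8 / ε * (n : ℝ) ^ (-1 : ℝ) := by
          rw [Real.rpow_neg_one]
          field_simp
          norm_num
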